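/- Let $n\ge 3$, let $M$ be a closed (i.e. compact, without boundary) smooth $n$-manifold, and let $g_0$ be a Riemannian metric on $M$ of class $C^k$, where $2\le k\le\infty$ (so $k=\infty$ is the smooth case). For a metric $g$ let $R(g)$ be its scalar curvature and $d\mathrm{vol}_g$ its Riemannian volume measure. Let $p\in M$ and let $U$ be a neighbourhood of $p$. (1) There are smooth positive functions $u_i: M\to\mathbb{R}$ $(i\in\mathbb{N})$ with $u_i=1$ outside $U$ such that the conformal $C^k$ metrics $$g_i:=u_i^{\frac{4}{n-2}}\,g_0$$ satisfy the following: - $g_i\to g_0$ on $M$ in the $C^0$-sense, but $g_i$ does not converge to $g_0$ in the $C^1$-sense; - there is a constant $C>0$ such that for all sufficiently large $i$, $$\int_M R(g_i)\,d\mathrm{vol}_{g_i}\ \ge\ \int_M R(g_0)\,d\mathrm{vol}_{g_0}+C;$$ - for all sufficiently large $i$ there are points $x_i,y_i\in M$ with $R(g_i)(x_i)>0$ and $R(g_i)(y_i)<0$. (2) Main Theorem 1 says: if $p>n$, if $C^2$ metrics $g_i$ on $M$ converge to a $C^2$ metric $g$ in the $W^{1,p}$-sense, and if $R(g_i)\ge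 0$ and $\int_M R(g_i)\,d\mathrm{vol}_{g_i}\ge\kappa$ for all $i$, then $\int_M R(g)\,d\mathrm{vol}_g\ge\kappa$. If the hypothesis $R(g_i)\ge0$ is dropped, then $W^{1,p}$-convergence cannot be weakened to $C^0$-convergence there, on any such $M$ and for any limit metric $g_0$. That is, the following assertion is false: for all $\kappa\in\mathbb{R}$ and all sequences $(g_i)$ of $C^k$ metrics on $M$ that converge to $g_0$ in the $C^0$-sense and satisfy $\int_M R(g_i)\,d\mathrm{vol}_{g_i}\ge\kappa$ for all $i$, one has $\int_M R(g_0)\,d\mathrm{vol}_{g_0}\ge\kappa$. The assertion remains false if it is restricted to sequences of metrics $g_i=f_i\,g_0$ conformal to $g_0$, with positive $C^k$ functions $f_i$. -/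

import Mathlib

open Set Filter Topology MeasureTheory Bundle
open scoped Manifold ContDiff

noncomputable section

namespace TotalScalarCurvature

/-! ### Coordinate formulas on an open subset of `ℝⁿ` -/

section Coordinates

variable {n : ℕ}

/-- The partial derivative `∂_c f`. -/
def pderiv (c : Fin n) (f : EuclideanSpace ℝ (Fin n) → ℝ) (y : EuclideanSpace ℝ (Fin n)) : ℝ :=
  fderiv ℝ f y (EuclideanSpace.single c 1)

/-- The Christoffel symbol
`Γ^c_{ab} = ½ ∑_d G^{cd} (∂_a G_{bd} + ∂_b G_{ad} - ∂_d G_{ab})`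
of a metric with coefficient matrix `G`. -/
def christoffel (G : EuclideanSpace ℝ (Fin n) → Matrix (Fin n) (Fin n) ℝ) (c a b : Fin n)
    (y : EuclideanSpace ℝ (Fin n)) : ℝ :=
  (1 / 2) * ∑ d, (G y)⁻¹ c d *
    (pderiv a (fun z => G z b d) y + pderiv b (fun z => G z a d) y
      - pderiv d (fun z => G z a b) y)

/-- The Ricci curvature `Ric_{ab} = ∑_c (∂_c Γ^c_{ab} - ∂_b Γ^c_{ac})
+ ∑_{c,d} (Γ^c_{cd} Γ^d_{ab} - Γ^c_{bd} Γ^d_{ac})`; it is positive on round spheres. -/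
def ricci (G : EuclideanSpace ℝ (Fin n) → Matrix (Fin n) (Fin n) ℝ) (a b : Fin n)
    (y : EuclideanSpace ℝ (Fin n)) : ℝ :=
  ∑ c, (pderiv c (christoffel G c a b) y - pderiv b (christoffel G c a c) y)
    + ∑ c, ∑ d, (christoffel G c c d y * christoffel G d a b y
      - christoffel G c b d y * christoffel G d a c y)

/-- The scalar curvature `∑_{a,b} G^{ab} Ric_{ab}`. -/
def coordScalar (G : EuclideanSpace ℝ (Fin n) → Matrix (Fin n) (Fin n) ℝ)
    (y : EuclideanSpace ℝ (Fin n)) : ℝ :=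
  ∑ a, ∑ b, (G y)⁻¹ a b * ricci G a b y

end Coordinates

/-! ### Riemannian metrics on a manifold -/

/-- A Riemannian metric of class `C^k` on an `n`-manifold `M` without boundary. -/
abbrev Metric (k : ℕ∞) (n : ℕ) (M : Type*) [TopologicalSpace M]
    [ChartedSpace (EuclideanSpace ℝ (Fin n)) M] [IsManifold (𝓡 n) ∞ M] :=
  ContMDiffRiemannianMetric (𝓡 n) (k : WithTop ℕ∞) (EuclideanSpace ℝ (Fin n))
    (fun x : M => TangentSpace (𝓡 n) x)

section Manifold

variable {k : ℕ∞} {n : ℕ} {M : Type*} [TopologicalSpace M]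
  [ChartedSpace (EuclideanSpace ℝ (Fin n)) M] [IsManifold (𝓡 n) ∞ M]

/-- The `a`-th standard basis vector of `ℝⁿ`, as a tangent vector of `ℝⁿ` at `y`. -/
def stdVector (y : EuclideanSpace ℝ (Fin n)) (a : Fin n) : TangentSpace (𝓡 n) y :=
  (EuclideanSpace.single a 1 : EuclideanSpace ℝ (Fin n))

/-- The coordinate vector `∂_a` of the chart around `x₀`, at the point of `M` with coordinates
`y`. -/
def coordVector (x₀ : M) (y : EuclideanSpace ℝ (Fin n)) (a : Fin n) :
    TangentSpace (𝓡 n) ((extChartAt (𝓡 n) x₀).symm y) :=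
  mfderiv (𝓡 n) (𝓡 n) (extChartAt (𝓡 n) x₀).symm y (stdVector y a)

/-- The coefficients `g_{ab} = g(∂_a, ∂_b)` in the chart around `x₀`, as functions on the target
of this chart. -/
def coeff (g : Metric k n M) (x₀ : M) (y : EuclideanSpace ℝ (Fin n)) :
    Matrix (Fin n) (Fin n) ℝ :=
  Matrix.of fun a b =>
    g.inner ((extChartAt (𝓡 n) x₀).symm y) (coordVector x₀ y a) (coordVector x₀ y b)

/-- The scalar curvature `R(g)` at `x`, computed in the chart around `x`. -/
def scalarCurvature (g : Metric k n M) (x : M) : ℝ :=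
  coordScalar (coeff g x) (extChartAt (𝓡 n) x x)

/-- The Riemannian volume of the domain of the chart around `x₀`: the measure
`√(det g_{ab}) dy` on the target of the chart, transported to `M`. -/
def chartVolume [MeasurableSpace M] (g : Metric k n M) (x₀ : M) : Measure M :=
  ((volume.restrict (extChartAt (𝓡 n) x₀).target).withDensity
    (fun y => ENNReal.ofReal (Real.sqrt (coeff g x₀ y).det))).map (extChartAt (𝓡 n) x₀).symm

/-- The Riemannian volume measure. By the change of variables formula the measures
`chartVolume g x₀` agree on the overlaps of the chart domains, so the least measure above all of
them is the one which restricts to `chartVolume g x₀` on the domain of each chart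
(if `M` is second countable). -/
def volumeMeasure [MeasurableSpace M] (g : Metric k n M) : Measure M :=
  ⨆ x₀ : M, chartVolume g x₀

/-- The total scalar curvature `∫_M R(g) dvol_g`. -/
def totalScalarCurvature [MeasurableSpace M] (g : Metric k n M) : ℝ :=
  ∫ x, scalarCurvature g x ∂(volumeMeasure g)

/-- `C⁰` convergence of metrics on compact sets (hence on all of `M` if `M` is compact): in each
chart, the coefficients converge uniformly on compact sets. -/
def ConvergesC0 (g : ℕ → Metric k n M) (g₀ : Metric k n M) : Prop :=
  ∀ (x₀ : M) (K : Set (EuclideanSpace ℝ (Fin n))), IsCompact K →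
    K ⊆ (extChartAt (𝓡 n) x₀).target → ∀ a b : Fin n,
      TendstoUniformlyOn (fun i y => coeff (g i) x₀ y a b) (fun y => coeff g₀ x₀ y a b) atTop K

/-- `C¹` convergence of metrics on compact sets: in each chart, the coefficients and their first
partial derivatives converge uniformly on compact sets. -/
def ConvergesC1 (g : ℕ → Metric k n M) (g₀ : Metric k n M) : Prop :=
  ConvergesC0 g g₀ ∧
  ∀ (x₀ : M) (K : Set (EuclideanSpace ℝ (Fin n))), IsCompact K →
    K ⊆ (extChartAt (𝓡 n) x₀).target → ∀ a b c : Fin n,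
      TendstoUniformlyOn (fun i => pderiv c (fun y => coeff (g i) x₀ y a b))
        (pderiv c (fun y => coeff g₀ x₀ y a b)) atTop K

/-- `g = f g₀` for a positive function `f` of class `C^k`. -/
def IsConformal (g g₀ : Metric k n M) : Prop :=
  ∃ f : M → ℝ, ContMDiff (𝓡 n) 𝓘(ℝ) (k : WithTop ℕ∞) f ∧ (∀ x, 0 < f x) ∧
    ∀ (x : M) (v w : TangentSpace (𝓡 n) x), g.inner x v w = f x * g₀.inner x v w

end Manifold

end TotalScalarCurvature

end

noncomputable section

set_option linter.unusedSectionVars false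

namespace TotalScalarCurvature

/-! ### Calculus of partial derivatives -/

section Calculus

variable {n : ℕ} {f g : EuclideanSpace ℝ (Fin n) → ℝ} {y : EuclideanSpace ℝ (Fin n)}

/-! The metrics are `g_N = e^{2φ} g₀` with `φ = N⁻¹ b sin (N (y^a - y^a(p)))`, where `b` is a bump
function supported in `U` and in the chart at `p`. The amplitude is at most `1/N`, which gives `C⁰`
convergence. The gradient has order one, and `∂_a φ (p) = 1` for every `N`, which excludes `C¹`
convergence.

For a conformal factor `e^{2φ}`, the scalar curvature density is `e^{(n-2)φ} (R - 2(n-1) Δφ -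
(n-1)(n-2) |dφ|²) dvol`. The divergence of `e^{(n-2)φ} ∇φ` is `e^{(n-2)φ} (Δφ + (n-2) |dφ|²)`.
Removing `Δφ` by this divergence reverses the sign of the gradient term and leaves `e^{(n-2)φ} (R +
(n-1)(n-2) |dφ|²) dvol` (`volDensity_mul_coordScalar_conformal`). As `N → ∞` the first term
converges to the total curvature of `g₀`. Near `p` one has `|dφ|² = g₀^{aa} cos²(N (y^a - y^a(p)))`,
and the squared cosine averages to `1/2` by the Riemann-Lebesgue lemma, so the second term stays
above a positive constant (`exists_le_setIntegral_gradSq`). This is the jump `C`.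

At points where the cosine vanishes and the sine is `±1`, the term `-2(n-1) Δφ` equals `±2(n-1) N
g₀^{aa}`. It outweighs the bounded `R(g₀)`, so both signs of curvature occur. The two negative
assertions follow by taking `κ` to be the total curvature of `g₀` plus `C`.

Two facts carry the local computation to `M`. The scalar curvature at `x` is defined in the chart
around `x`, so its coordinate invariance is needed before one fixed chart can be used; it follows
from uniqueness of the Levi-Civita connection and gauge covariance of curvature
(`coordScalar_eq_of_pullback`). The volume is a supremum of chart measures, and
`volumeMeasure_restrict_source` identifies it on each chart domain. -/

theorem pderiv_congr (h : f =ᶠ[𝓝 y] g) (c : Fin n) : pderiv c f y = pderiv c g y := by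
  rw [pderiv, pderiv, h.fderiv_eq]

@[simp] theorem pderiv_const (c : Fin n) (r : ℝ) : pderiv c (fun _ => r) y = 0 := by
  simp [pderiv]

theorem pderiv_add (hf : DifferentiableAt ℝ f y) (hg : DifferentiableAt ℝ g y) (c : Fin n) :
    pderiv c (fun z => f z + g z) y = pderiv c f y + pderiv c g y := by
  simp [pderiv, fderiv_fun_add hf hg]

theorem pderiv_sub (hf : DifferentiableAt ℝ f y) (hg : DifferentiableAt ℝ g y) (c : Fin n) :
    pderiv c (fun z => f z - g z) y = pderiv c f y - pderiv c g y := by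
  simp [pderiv, fderiv_fun_sub hf hg]

theorem pderiv_mul (hf : DifferentiableAt ℝ f y) (hg : DifferentiableAt ℝ g y) (c : Fin n) :
    pderiv c (fun z => f z * g z) y = pderiv c f y * g y + f y * pderiv c g y := by
  simp only [pderiv, fderiv_fun_mul hf hg, add_apply,
    smul_apply, smul_eq_mul]
  ring

theorem pderiv_const_mul (hf : DifferentiableAt ℝ f y) (r : ℝ) (c : Fin n) :
    pderiv c (fun z => r * f z) y = r * pderiv c f y := by
  rw [pderiv_mul (differentiableAt_const r) hf, pderiv_const]; ring

theorem pderiv_sum {ι : Type*} {s : Finset ι} {F : ι → EuclideanSpace ℝ (Fin n) → ℝ}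
    (hF : ∀ i ∈ s, DifferentiableAt ℝ (F i) y) (c : Fin n) :
    pderiv c (fun z => ∑ i ∈ s, F i z) y = ∑ i ∈ s, pderiv c (F i) y := by
  simp [pderiv, fderiv_fun_sum hF]

theorem pderiv_scomp {h : ℝ → ℝ} {h' : ℝ} (hh : HasDerivAt h h' (f y))
    (hf : DifferentiableAt ℝ f y) (c : Fin n) :
    pderiv c (fun z => h (f z)) y = h' * pderiv c f y := by
  have := hh.comp_hasFDerivAt y hf.hasFDerivAt
  have h2 : fderiv ℝ (fun z => h (f z)) y = h' • fderiv ℝ f y := this.fderiv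
  simp [pderiv, h2]

theorem fderiv_eq_sum_pderiv (v : EuclideanSpace ℝ (Fin n)) :
    fderiv ℝ f y v = ∑ c, v c * pderiv c f y := by
  have hv : v = ∑ c, v c • EuclideanSpace.single c (1 : ℝ) := by
    ext i
    simp [Pi.single_apply]
  conv_lhs => rw [hv]
  simp [pderiv]

theorem pderiv_comp {m : ℕ} {ψ : EuclideanSpace ℝ (Fin n) → EuclideanSpace ℝ (Fin m)}
    {f : EuclideanSpace ℝ (Fin m) → ℝ} (hf : DifferentiableAt ℝ f (ψ y))
    (hψ : DifferentiableAt ℝ ψ y) (a : Fin n) :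
    pderiv a (fun z => f (ψ z)) y = ∑ c, pderiv a (fun z => ψ z c) y * pderiv c f (ψ y) := by
  have h2 : fderiv ℝ (fun z => f (ψ z)) y = (fderiv ℝ f (ψ y)).comp (fderiv ℝ ψ y) :=
    fderiv_comp y hf hψ
  rw [pderiv, h2, ContinuousLinearMap.comp_apply, fderiv_eq_sum_pderiv]
  refine Finset.sum_congr rfl fun c _ => ?_
  congr 1
  have : fderiv ℝ (fun z => ψ z c) y
      = (EuclideanSpace.proj (𝕜 := ℝ) c : EuclideanSpace ℝ (Fin m) →L[ℝ] ℝ).comp (fderiv ℝ ψ y) := by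
    have := (EuclideanSpace.proj (𝕜 := ℝ) c : EuclideanSpace ℝ (Fin m) →L[ℝ] ℝ).hasFDerivAt.comp y
      hψ.hasFDerivAt
    exact this.fderiv
  rw [pderiv, this]
  rfl

theorem contDiffAt_pderiv {k m : WithTop ℕ∞} (hf : ContDiffAt ℝ k f y) (hm : m + 1 ≤ k)
    (c : Fin n) : ContDiffAt ℝ m (pderiv c f) y :=
  (hf.fderiv_right hm).clm_apply contDiffAt_const

theorem pderiv_comm (hf : ContDiffAt ℝ 2 f y) (a b : Fin n) :
    pderiv a (pderiv b f) y = pderiv b (pderiv a f) y := by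
  have hd : DifferentiableAt ℝ (fderiv ℝ f) y :=
    (hf.fderiv_right (m := 1) (by norm_num)).differentiableAt (by norm_num)
  have key : ∀ a b : Fin n, pderiv a (pderiv b f) y
      = fderiv ℝ (fderiv ℝ f) y (EuclideanSpace.single a 1) (EuclideanSpace.single b 1) := by
    intro a b
    have : fderiv ℝ (fun z => fderiv ℝ f z (EuclideanSpace.single b (1 : ℝ))) y
        = _ := fderiv_clm_apply hd (differentiableAt_const _)
    change fderiv ℝ (fun z => fderiv ℝ f z (EuclideanSpace.single b (1 : ℝ))) y _ = _
    rw [this]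
    simp
  rw [key, key]
  exact (hf.isSymmSndFDerivAt (by simp)).eq _ _

end Calculus

/-! ### Matrix valued functions -/

section MatrixCalculus

variable {n m : ℕ} {N N' : EuclideanSpace ℝ (Fin n) → Matrix (Fin m) (Fin m) ℝ}
  {y : EuclideanSpace ℝ (Fin n)}

/-- The entrywise partial derivative of a matrix valued function. -/
def mpderiv (c : Fin n) (N : EuclideanSpace ℝ (Fin n) → Matrix (Fin m) (Fin m) ℝ)
    (y : EuclideanSpace ℝ (Fin n)) : Matrix (Fin m) (Fin m) ℝ :=
  Matrix.of fun a b => pderiv c (fun z => N z a b) y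

@[simp] theorem mpderiv_apply (c : Fin n) (a b : Fin m) :
    mpderiv c N y a b = pderiv c (fun z => N z a b) y := rfl

/-- All entries of `N` are of class `C^k` at `y`. -/
def MatContDiffAt (k : WithTop ℕ∞) (N : EuclideanSpace ℝ (Fin n) → Matrix (Fin m) (Fin m) ℝ)
    (y : EuclideanSpace ℝ (Fin n)) : Prop :=
  ∀ a b, ContDiffAt ℝ k (fun z => N z a b) y

variable {k : WithTop ℕ∞}

theorem MatContDiffAt.of_le {k' : WithTop ℕ∞} (h : MatContDiffAt k N y) (hk : k' ≤ k) :
    MatContDiffAt k' N y := fun a b => (h a b).of_le hk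

theorem MatContDiffAt.differentiableAt (h : MatContDiffAt k N y) (hk : k ≠ 0) (a b : Fin m) :
    DifferentiableAt ℝ (fun z => N z a b) y := (h a b).differentiableAt hk

theorem MatContDiffAt.eventually (h : MatContDiffAt k N y) (hk : k ≠ ∞) :
    ∀ᶠ z in 𝓝 y, MatContDiffAt k N z := by
  unfold MatContDiffAt
  simp only [eventually_all]
  exact fun a b => (h a b).eventually hk

theorem MatContDiffAt.mul (h : MatContDiffAt k N y) (h' : MatContDiffAt k N' y) :
    MatContDiffAt k (fun z => N z * N' z) y := fun a b => by
  simp only [Matrix.mul_apply]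
  exact ContDiffAt.sum fun i _ => (h a i).mul (h' i b)

theorem MatContDiffAt.transpose (h : MatContDiffAt k N y) :
    MatContDiffAt k (fun z => (N z).transpose) y := fun a b => h b a

theorem MatContDiffAt.det (h : MatContDiffAt k N y) : ContDiffAt ℝ k (fun z => (N z).det) y := by
  simp only [Matrix.det_apply']
  exact ContDiffAt.sum fun σ _ => contDiffAt_const.mul (contDiffAt_prod fun i _ => h _ _)

/-- Cramer's rule: the inverse is the adjugate over the determinant, and each entry of the adjugate
is again a determinant. -/
theorem MatContDiffAt.inv (h : MatContDiffAt k N y) (hdet : (N y).det ≠ 0) :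
    MatContDiffAt k (fun z => (N z)⁻¹) y := fun a b => by
  simp only [Matrix.inv_def, Ring.inverse_eq_inv', Matrix.smul_apply, smul_eq_mul]
  refine (h.det.inv hdet).mul ?_
  simp only [Matrix.adjugate_apply]
  refine MatContDiffAt.det (N := fun z => (N z).updateRow b (Pi.single a 1)) fun i j => ?_
  simp only [Matrix.updateRow_apply]
  split_ifs
  · exact contDiffAt_const
  · exact h i j

theorem mpderiv_congr (h : N =ᶠ[𝓝 y] N') (c : Fin n) : mpderiv c N y = mpderiv c N' y := by
  ext a b
  exact pderiv_congr (h.mono fun z hz => by simp only [hz]) c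

theorem mpderiv_mul (h : MatContDiffAt 1 N y) (h' : MatContDiffAt 1 N' y) (c : Fin n) :
    mpderiv c (fun z => N z * N' z) y = mpderiv c N y * N' y + N y * mpderiv c N' y := by
  ext a b
  simp only [mpderiv_apply, Matrix.mul_apply, Matrix.add_apply]
  rw [pderiv_sum fun i _ => ((h.differentiableAt one_ne_zero a i).fun_mul
    (h'.differentiableAt one_ne_zero i b)), ← Finset.sum_add_distrib]
  exact Finset.sum_congr rfl fun i _ => pderiv_mul (h.differentiableAt one_ne_zero a i)
    (h'.differentiableAt one_ne_zero i b) c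

theorem mpderiv_add (h : MatContDiffAt 1 N y) (h' : MatContDiffAt 1 N' y) (c : Fin n) :
    mpderiv c (fun z => N z + N' z) y = mpderiv c N y + mpderiv c N' y := by
  ext a b
  exact pderiv_add (h.differentiableAt one_ne_zero a b) (h'.differentiableAt one_ne_zero a b) c

theorem mpderiv_transpose (c : Fin n) :
    mpderiv c (fun z => (N z).transpose) y = (mpderiv c N y).transpose := rfl

/-- Jacobi's formula. -/
theorem pderiv_det (h : MatContDiffAt 1 N y) (c : Fin n) :
    pderiv c (fun z => (N z).det) y = ((N y).adjugate * mpderiv c N y).trace := by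
  have hd := fun a b => h.differentiableAt one_ne_zero a b
  have hp : ∀ σ : Equiv.Perm (Fin m), DifferentiableAt ℝ (fun z => ∏ i, N z (σ i) i) y :=
    fun σ => (contDiffAt_prod fun i _ => h (σ i) i).differentiableAt one_ne_zero
  -- By Cramer's rule each diagonal entry is a determinant with one column differentiated. The
  -- Leibniz expansions of both sides then agree permutation by permutation.
  have h1 : ∀ i, ((N y).adjugate * mpderiv c N y) i i
      = ((N y).updateCol i fun a => mpderiv c N y a i).det := by
    intro i
    rw [← Matrix.cramer_apply, Matrix.cramer_eq_adjugate_mulVec]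
    rfl
  simp only [Matrix.trace, Matrix.diag_apply, h1]
  simp only [Matrix.det_apply']
  rw [pderiv_sum fun σ _ => (differentiableAt_const _).fun_mul (hp σ), Finset.sum_comm]
  refine Finset.sum_congr rfl fun σ _ => ?_
  rw [pderiv_const_mul (hp σ), ← Finset.mul_sum]
  congr 1
  rw [pderiv, fderiv_finsetProd fun i _ => hd (σ i) i]
  simp only [sum_apply, smul_apply, smul_eq_mul]
  refine Finset.sum_congr rfl fun i _ => ?_
  rw [← Finset.mul_prod_erase _ _ (Finset.mem_univ i), mul_comm]
  congr 1
  · simp [pderiv]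
  · refine Finset.prod_congr rfl fun j hj => ?_
    simp [(Finset.mem_erase.1 hj).1]

end MatrixCalculus

/-! ### The Levi-Civita connection in coordinates -/

section Connection

variable {n : ℕ} {G : EuclideanSpace ℝ (Fin n) → Matrix (Fin n) (Fin n) ℝ}
  {y : EuclideanSpace ℝ (Fin n)}

/-- The connection matrices `(A_a)^c_b = Γ^c_{ab}`. -/
def conn (G : EuclideanSpace ℝ (Fin n) → Matrix (Fin n) (Fin n) ℝ) (a : Fin n)
    (y : EuclideanSpace ℝ (Fin n)) : Matrix (Fin n) (Fin n) ℝ :=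
  Matrix.of fun c b => christoffel G c a b y

/-- The Christoffel symbols with lowered upper index. -/
def lowerConn (G : EuclideanSpace ℝ (Fin n) → Matrix (Fin n) (Fin n) ℝ) (a : Fin n)
    (y : EuclideanSpace ℝ (Fin n)) : Matrix (Fin n) (Fin n) ℝ :=
  Matrix.of fun d b => (1 / 2) * (pderiv a (fun z => G z b d) y + pderiv b (fun z => G z a d) y
      - pderiv d (fun z => G z a b) y)

theorem conn_eq_inv_mul (a : Fin n) : conn G a y = (G y)⁻¹ * lowerConn G a y := by
  ext c b
  simp only [conn, christoffel, lowerConn, Matrix.of_apply, Matrix.mul_apply, Finset.mul_sum]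
  exact Finset.sum_congr rfl fun d _ => by ring

theorem pderiv_entry_symm (hs : ∀ z, (G z).IsSymm) (a b c : Fin n) :
    pderiv c (fun z => G z a b) y = pderiv c (fun z => G z b a) y := by
  congr 1
  funext z
  exact (hs z).apply b a

theorem christoffel_symm (hs : ∀ z, (G z).IsSymm) (c a b : Fin n) :
    christoffel G c a b = christoffel G c b a := by
  funext y
  simp only [christoffel]
  congr 1
  refine Finset.sum_congr rfl fun d _ => ?_
  rw [pderiv_entry_symm hs a b d]
  ring

theorem conn_symm (hs : ∀ z, (G z).IsSymm) (a b c : Fin n) : conn G a y c b = conn G b y c a :=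
  congrFun (christoffel_symm hs c a b) y

/-- Metric compatibility. The product `G A_c` is the lowered symbol, and adding its transpose
cancels the two derivatives that are antisymmetric in `a, b`. -/
theorem mpderiv_eq_conn (hs : ∀ z, (G z).IsSymm) (hdet : (G y).det ≠ 0) (c : Fin n) :
    mpderiv c G y = (conn G c y).transpose * G y + G y * conn G c y := by
  have h1 : G y * conn G c y = lowerConn G c y := by
    rw [conn_eq_inv_mul, Matrix.mul_nonsing_inv_cancel_left _ _ (isUnit_iff_ne_zero.2 hdet)]
  have h2 : (conn G c y).transpose * G y = (lowerConn G c y).transpose := by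
    rw [← h1, Matrix.transpose_mul, hs y]
  rw [h1, h2]
  ext a b
  simp only [mpderiv_apply, lowerConn, Matrix.add_apply, Matrix.transpose_apply, Matrix.of_apply]
  rw [pderiv_entry_symm hs b a c, pderiv_entry_symm hs c b a, pderiv_entry_symm hs c a b]
  ring

/-- The Levi-Civita connection is the unique symmetric connection compatible with the metric. -/
theorem conn_unique (hs : ∀ z, (G z).IsSymm) (hdet : (G y).det ≠ 0)
    (B : Fin n → Matrix (Fin n) (Fin n) ℝ) (hB : ∀ a b c, B a c b = B b c a)
    (hm : ∀ c, mpderiv c G y = (B c).transpose * G y + G y * B c) (a : Fin n) :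
    conn G a y = B a := by
  have hX : ∀ a b d, (G y * B a) d b = (G y * B b) d a := by
    intro a b d
    simp only [Matrix.mul_apply]
    exact Finset.sum_congr rfl fun e _ => by rw [hB a b e]
  have hd : ∀ c a b, pderiv c (fun z => G z a b) y = (G y * B c) b a + (G y * B c) a b := by
    intro c a b
    have h1 : (B c).transpose * G y = (G y * B c).transpose := by
      rw [Matrix.transpose_mul, hs y]
    have := congrFun (congrFun (hm c) a) b
    rw [h1] at this
    exact this
  -- Koszul's argument: compatibility writes the three derivatives of `G` as six terms in `G B`; by
  -- torsion-freeness four of them cancel and the other two coincide.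
  have : lowerConn G a y = G y * B a := by
    ext d b
    simp only [lowerConn, Matrix.of_apply, hd]
    rw [hX b a d, hX a d b, hX b d a]
    ring
  rw [conn_eq_inv_mul, this, Matrix.nonsing_inv_mul_cancel_left _ _ (isUnit_iff_ne_zero.2 hdet)]

theorem matContDiffAt_conn {k m : WithTop ℕ∞} (hG : MatContDiffAt k G y) (hm : m + 1 ≤ k)
    (hdet : (G y).det ≠ 0) (a : Fin n) : MatContDiffAt m (conn G a) y := fun c b => by
  simp only [conn, christoffel, Matrix.of_apply]
  refine contDiffAt_const.mul (ContDiffAt.sum fun d _ => ?_)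
  exact ((hG.inv hdet c d).of_le (le_self_add.trans hm)).mul
    (((contDiffAt_pderiv (hG _ _) hm _).add (contDiffAt_pderiv (hG _ _) hm _)).sub
      (contDiffAt_pderiv (hG _ _) hm _))

/-- The curvature `∂_a A_b - ∂_b A_a + [A_a, A_b]` of a connection. -/
def curv (A : Fin n → EuclideanSpace ℝ (Fin n) → Matrix (Fin n) (Fin n) ℝ) (a b : Fin n)
    (y : EuclideanSpace ℝ (Fin n)) : Matrix (Fin n) (Fin n) ℝ :=
  mpderiv a (A b) y - mpderiv b (A a) y + A a y * A b y - A b y * A a y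

/-- Ricci is a contraction of the curvature 2-form of the connection matrices. In this form the
gauge and pullback laws for curvature apply to it. -/
theorem ricci_eq_curv (hs : ∀ z, (G z).IsSymm) (a b : Fin n) :
    ricci G a b y = ∑ c, curv (conn G) c b y c a := by
  rw [ricci, ← Finset.sum_add_distrib]
  refine Finset.sum_congr rfl fun c _ => ?_
  simp only [curv, Matrix.sub_apply, Matrix.add_apply, mpderiv_apply, conn, Matrix.of_apply,
    Matrix.mul_apply, add_sub_assoc]
  rw [Finset.sum_sub_distrib, christoffel_symm hs c b a, christoffel_symm hs c c a]
  simp only [christoffel_symm hs _ b a, christoffel_symm hs _ c a]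

theorem coordScalar_eq_trace :
    coordScalar G y = ((G y)⁻¹ * (Matrix.of fun a b => ricci G a b y).transpose).trace := by
  simp [coordScalar, Matrix.trace, Matrix.mul_apply]

/-- Differentiate the intertwining relation `P A_a = A'_a P + ∂_a P` in direction `b` and
antisymmetrize: the second derivatives of `P` cancel, and substituting the relation for `∂P`
produces the commutators. No inverse of `P` is involved. -/
theorem curv_gauge {P : EuclideanSpace ℝ (Fin n) → Matrix (Fin n) (Fin n) ℝ}
    {A A' : Fin n → EuclideanSpace ℝ (Fin n) → Matrix (Fin n) (Fin n) ℝ}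
    (hP : MatContDiffAt 2 P y) (hA : ∀ a, MatContDiffAt 1 (A a) y)
    (hA' : ∀ a, MatContDiffAt 1 (A' a) y)
    (h : ∀ a, ∀ᶠ z in 𝓝 y, P z * A a z = A' a z * P z + mpderiv a P z) (a b : Fin n) :
    P y * curv A a b y = curv A' a b y * P y := by
  have hP1 := hP.of_le one_le_two
  have hdP : ∀ a, MatContDiffAt 1 (mpderiv a P) y := fun a c d =>
    contDiffAt_pderiv (hP c d) (by norm_num) a
  have key : ∀ a b, mpderiv b P y * A a y + P y * mpderiv b (A a) y
      = mpderiv b (A' a) y * P y + A' a y * mpderiv b P y + mpderiv b (mpderiv a P) y := by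
    intro a b
    have hmul : MatContDiffAt 1 (fun z => A' a z * P z) y := (hA' a).mul hP1
    rw [← mpderiv_mul hP1 (hA a), mpderiv_congr (h a), mpderiv_add hmul (hdP a),
      mpderiv_mul (hA' a) hP1]
  have hc : mpderiv b (mpderiv a P) y = mpderiv a (mpderiv b P) y := by
    ext c d
    exact pderiv_comm (hP c d) b a
  have e : ∀ a, mpderiv a P y = P y * A a y - A' a y * P y := fun a => by
    rw [(h a).self_of_nhds]; abel
  have k1 := key a b
  have k2 := key b a
  rw [hc] at k1
  have k3 : P y * (mpderiv a (A b) y - mpderiv b (A a) y)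
      = (mpderiv a (A' b) y - mpderiv b (A' a) y) * P y
        + (A' b y * mpderiv a P y - A' a y * mpderiv b P y)
        - (mpderiv a P y * A b y - mpderiv b P y * A a y) := by
    have h1 : P y * mpderiv a (A b) y = mpderiv a (A' b) y * P y + A' b y * mpderiv a P y
      + mpderiv a (mpderiv b P) y - mpderiv a P y * A b y := by rw [← k2]; abel
    have h2 : P y * mpderiv b (A a) y = mpderiv b (A' a) y * P y + A' a y * mpderiv b P y
      + mpderiv a (mpderiv b P) y - mpderiv b P y * A a y := by rw [← k1]; abel
    rw [mul_sub, h1, h2]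
    noncomm_ring
  rw [curv, curv, add_sub_assoc, mul_add, k3, e a, e b]
  noncomm_ring

/-! ### Behaviour under changes of coordinates -/

/-- The Jacobian matrix `P^i_a = ∂_a ψ^i`. -/
def jacobian (ψ : EuclideanSpace ℝ (Fin n) → EuclideanSpace ℝ (Fin n))
    (y : EuclideanSpace ℝ (Fin n)) : Matrix (Fin n) (Fin n) ℝ :=
  Matrix.of fun i a => pderiv a (fun z => ψ z i) y

theorem contDiffAt_entry {k : WithTop ℕ∞} {ψ : EuclideanSpace ℝ (Fin n) → EuclideanSpace ℝ (Fin n)}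
    (hψ : ContDiffAt ℝ k ψ y) (i : Fin n) : ContDiffAt ℝ k (fun z => ψ z i) y :=
  (contDiffAt_piLp 2).1 hψ i

theorem matContDiffAt_jacobian {k m : WithTop ℕ∞}
    {ψ : EuclideanSpace ℝ (Fin n) → EuclideanSpace ℝ (Fin n)}
    (hψ : ContDiffAt ℝ k ψ y) (hm : m + 1 ≤ k) : MatContDiffAt m (jacobian ψ) y :=
  fun i a => contDiffAt_pderiv (contDiffAt_entry hψ i) hm a

theorem mpderiv_comp {ψ : EuclideanSpace ℝ (Fin n) → EuclideanSpace ℝ (Fin n)}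
    {N : EuclideanSpace ℝ (Fin n) → Matrix (Fin n) (Fin n) ℝ}
    (hψ : ContDiffAt ℝ 1 ψ y) (hN : MatContDiffAt 1 N (ψ y)) (a : Fin n) :
    mpderiv a (fun z => N (ψ z)) y = ∑ i, jacobian ψ y i a • mpderiv i N (ψ y) := by
  ext c d
  rw [Matrix.sum_apply]
  exact pderiv_comp (f := fun z => N z c d) (hN.differentiableAt one_ne_zero c d)
    (hψ.differentiableAt one_ne_zero) a

/-- The pullback of a connection under `ψ`. -/
def pullbackConn (ψ : EuclideanSpace ℝ (Fin n) → EuclideanSpace ℝ (Fin n))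
    (A : Fin n → EuclideanSpace ℝ (Fin n) → Matrix (Fin n) (Fin n) ℝ) (a : Fin n)
    (y : EuclideanSpace ℝ (Fin n)) : Matrix (Fin n) (Fin n) ℝ :=
  ∑ i, jacobian ψ y i a • A i (ψ y)

theorem MatContDiffAt.comp {k : WithTop ℕ∞}
    {ψ : EuclideanSpace ℝ (Fin n) → EuclideanSpace ℝ (Fin n)}
    {N : EuclideanSpace ℝ (Fin n) → Matrix (Fin n) (Fin n) ℝ} (hN : MatContDiffAt k N (ψ y))
    (hψ : ContDiffAt ℝ k ψ y) : MatContDiffAt k (fun z => N (ψ z)) y :=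
  fun a b => ContDiffAt.comp (g := fun z => N z a b) y (hN a b) hψ

theorem matContDiffAt_pullbackConn {ψ : EuclideanSpace ℝ (Fin n) → EuclideanSpace ℝ (Fin n)}
    {A : Fin n → EuclideanSpace ℝ (Fin n) → Matrix (Fin n) (Fin n) ℝ}
    (hψ : ContDiffAt ℝ 2 ψ y) (hA : ∀ a, MatContDiffAt 1 (A a) (ψ y)) (a : Fin n) :
    MatContDiffAt 1 (pullbackConn ψ A a) y := fun c d => by
  simp only [pullbackConn, Matrix.sum_apply, Matrix.smul_apply, smul_eq_mul]
  exact ContDiffAt.sum fun i _ => (matContDiffAt_jacobian hψ (by norm_num) i a).mul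
    ((hA i).comp (hψ.of_le one_le_two) c d)

/-- The only terms that are not tensorial contain second derivatives of `ψ`; these are symmetric in
`a, b` and drop out of the antisymmetrization (`hJc`). -/
theorem curv_pullbackConn {ψ : EuclideanSpace ℝ (Fin n) → EuclideanSpace ℝ (Fin n)}
    {A : Fin n → EuclideanSpace ℝ (Fin n) → Matrix (Fin n) (Fin n) ℝ}
    (hψ : ContDiffAt ℝ 2 ψ y) (hA : ∀ a, MatContDiffAt 1 (A a) (ψ y)) (a b : Fin n) :
    curv (pullbackConn ψ A) a b y
      = ∑ i, ∑ j, (jacobian ψ y i a * jacobian ψ y j b) • curv A i j (ψ y) := by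
  have hψ1 := hψ.of_le one_le_two
  have hJ : MatContDiffAt 1 (jacobian ψ) y := matContDiffAt_jacobian hψ (by norm_num)
  have hd : ∀ a b, mpderiv b (pullbackConn ψ A a) y
      = ∑ i, pderiv b (fun z => jacobian ψ z i a) y • A i (ψ y)
        + ∑ i, ∑ j, (jacobian ψ y i a * jacobian ψ y j b) • mpderiv j (A i) (ψ y) := by
    intro a b
    have hAψ : ∀ i c d, DifferentiableAt ℝ (fun z => A i (ψ z) c d) y := fun i =>
      ((hA i).comp hψ1).differentiableAt one_ne_zero
    have hJd := fun i => hJ.differentiableAt one_ne_zero i a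
    ext c d
    simp only [mpderiv_apply, pullbackConn, Matrix.sum_apply, Matrix.smul_apply, smul_eq_mul,
      Matrix.add_apply]
    rw [pderiv_sum fun i _ => (hJd i).fun_mul (hAψ i c d), ← Finset.sum_add_distrib]
    refine Finset.sum_congr rfl fun i _ => ?_
    rw [pderiv_mul (hJd i) (hAψ i c d)]
    congr 1
    have := congrFun (congrFun (mpderiv_comp hψ1 (hA i) b) c) d
    simp only [mpderiv_apply, Matrix.sum_apply, Matrix.smul_apply, smul_eq_mul] at this
    rw [this, Finset.mul_sum]
    exact Finset.sum_congr rfl fun j _ => by ring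
  have hJc : ∀ i, pderiv b (fun z => jacobian ψ z i a) y = pderiv a (fun z => jacobian ψ z i b) y :=
    fun i => pderiv_comm (contDiffAt_entry hψ i) b a
  have hmul : ∀ a b, pullbackConn ψ A a y * pullbackConn ψ A b y
      = ∑ i, ∑ j, (jacobian ψ y i a * jacobian ψ y j b) • (A i (ψ y) * A j (ψ y)) := by
    intro a b
    simp only [pullbackConn, Finset.sum_mul, Finset.mul_sum, Matrix.smul_mul, Matrix.mul_smul,
      smul_smul]
    rw [Finset.sum_comm]
    exact Finset.sum_congr rfl fun i _ => Finset.sum_congr rfl fun j _ => by rw [mul_comm]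
  have hsw : ∀ F : Fin n → Fin n → Matrix (Fin n) (Fin n) ℝ,
      ∑ i, ∑ j, (jacobian ψ y i b * jacobian ψ y j a) • F i j
        = ∑ i, ∑ j, (jacobian ψ y i a * jacobian ψ y j b) • F j i := by
    intro F
    rw [Finset.sum_comm]
    exact Finset.sum_congr rfl fun i _ => Finset.sum_congr rfl fun j _ => by rw [mul_comm]
  simp only [curv]
  rw [hd, hd, hmul, hmul, hsw (fun i j => mpderiv j (A i) (ψ y)),
    hsw (fun i j => A i (ψ y) * A j (ψ y))]
  simp only [hJc, smul_sub, smul_add, Finset.sum_sub_distrib, Finset.sum_add_distrib]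
  abel

/-- The transformation law of the Levi-Civita connection under a change of coordinates. -/
theorem jacobian_mul_conn {G' : EuclideanSpace ℝ (Fin n) → Matrix (Fin n) (Fin n) ℝ}
    {ψ : EuclideanSpace ℝ (Fin n) → EuclideanSpace ℝ (Fin n)}
    (hs : ∀ z, (G z).IsSymm) (hs' : ∀ z, (G' z).IsSymm) (hψ : ContDiffAt ℝ 2 ψ y)
    (hG : MatContDiffAt 1 G (ψ y)) (hdet' : (G' y).det ≠ 0)
    (h : ∀ᶠ z in 𝓝 y, G' z = (jacobian ψ z).transpose * (G (ψ z) * jacobian ψ z)) (a : Fin n) :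
    jacobian ψ y * conn G' a y
      = pullbackConn ψ (conn G) a y * jacobian ψ y + mpderiv a (jacobian ψ) y := by
  have hψ1 := hψ.of_le one_le_two
  have hJ : MatContDiffAt 1 (jacobian ψ) y := matContDiffAt_jacobian hψ (by norm_num)
  have hy := h.self_of_nhds
  set P := jacobian ψ y with hP
  -- The determinant of `G'` factors through those of `P` and `G ∘ ψ`, so invertibility of the
  -- Jacobian is a consequence and not an assumption.
  have hdets : P.det ≠ 0 ∧ (G (ψ y)).det ≠ 0 := by
    rw [hy, Matrix.det_mul, Matrix.det_mul, Matrix.det_transpose] at hdet'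
    refine ⟨fun h0 => hdet' ?_, fun h0 => hdet' ?_⟩ <;> rw [h0] <;> ring
  have hu : IsUnit P.det := isUnit_iff_ne_zero.2 hdets.1
  have huT : IsUnit P.transpose.det := by rwa [Matrix.det_transpose]
  have hcomp : ∀ c, mpderiv c (fun z => G (ψ z)) y
      = (pullbackConn ψ (conn G) c y).transpose * G (ψ y)
        + G (ψ y) * pullbackConn ψ (conn G) c y := by
    intro c
    rw [mpderiv_comp hψ1 hG c]
    simp only [mpderiv_eq_conn hs hdets.2, pullbackConn, Matrix.transpose_sum, Finset.sum_mul,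
      Finset.mul_sum, Matrix.transpose_smul, Matrix.smul_mul, Matrix.mul_smul, smul_add,
      Finset.sum_add_distrib]
  -- Solve the asserted law for the connection of `G'`. The resulting matrices are torsion-free and
  -- compatible with `G'`, so uniqueness identifies them.
  have := conn_unique hs' hdet'
    (fun a => P⁻¹ * (pullbackConn ψ (conn G) a y * P + mpderiv a (jacobian ψ) y)) ?_ ?_ a
  · rw [this, Matrix.mul_nonsing_inv_cancel_left _ _ hu]
  · intro a b c
    simp only [Matrix.mul_apply (M := P⁻¹)]
    refine Finset.sum_congr rfl fun k _ => ?_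
    congr 1
    simp only [Matrix.add_apply, mpderiv_apply]
    congr 1
    · simp only [pullbackConn, Matrix.mul_apply, Matrix.sum_apply, Matrix.smul_apply, smul_eq_mul,
        Finset.sum_mul]
      rw [Finset.sum_comm]
      refine Finset.sum_congr rfl fun i _ => Finset.sum_congr rfl fun j _ => ?_
      rw [conn_symm hs j i k]
      simp only [hP]
      ring
    · exact pderiv_comm (contDiffAt_entry hψ k) a b
  · intro c
    have hGψ : MatContDiffAt 1 (fun z => G (ψ z)) y := hG.comp hψ1
    have hm : MatContDiffAt 1 (fun z => G (ψ z) * jacobian ψ z) y := hGψ.mul hJ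
    rw [mpderiv_congr h, mpderiv_mul hJ.transpose hm, mpderiv_mul hGψ hJ, mpderiv_transpose,
      hcomp, hy]
    simp only [← hP, Matrix.transpose_mul, Matrix.transpose_nonsing_inv, Matrix.transpose_add]
    have e1 : ∀ X : Matrix (Fin n) (Fin n) ℝ, P * (P⁻¹ * X) = X := fun X =>
      Matrix.mul_nonsing_inv_cancel_left _ _ hu
    have e2 : ∀ X : Matrix (Fin n) (Fin n) ℝ, P.transpose⁻¹ * (P.transpose * X) = X := fun X =>
      Matrix.nonsing_inv_mul_cancel_left _ _ huT
    simp only [mul_assoc, e1, e2, add_mul, mul_add]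
    abel

/-- The scalar curvature is invariant under changes of coordinates. -/
theorem coordScalar_eq_of_pullback {G' : EuclideanSpace ℝ (Fin n) → Matrix (Fin n) (Fin n) ℝ}
    {ψ : EuclideanSpace ℝ (Fin n) → EuclideanSpace ℝ (Fin n)}
    (hs : ∀ z, (G z).IsSymm) (hs' : ∀ z, (G' z).IsSymm) (hψ : ContDiffAt ℝ 3 ψ y)
    (hG : MatContDiffAt 2 G (ψ y)) (hG' : MatContDiffAt 2 G' y) (hdet' : (G' y).det ≠ 0)
    (h : ∀ᶠ z in 𝓝 y, G' z = (jacobian ψ z).transpose * (G (ψ z) * jacobian ψ z)) :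
    coordScalar G' y = coordScalar G (ψ y) := by
  have hψ2 : ContDiffAt ℝ 2 ψ y := hψ.of_le (by norm_num)
  have hJ : MatContDiffAt 2 (jacobian ψ) y := matContDiffAt_jacobian hψ (by norm_num)
  have hy := h.self_of_nhds
  set P := jacobian ψ y with hP
  have hdets : P.det ≠ 0 ∧ (G (ψ y)).det ≠ 0 := by
    rw [hy, Matrix.det_mul, Matrix.det_mul, Matrix.det_transpose] at hdet'
    refine ⟨fun h0 => hdet' ?_, fun h0 => hdet' ?_⟩ <;> rw [h0] <;> ring
  have hu : IsUnit P.det := isUnit_iff_ne_zero.2 hdets.1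
  have huT : IsUnit P.transpose.det := by rwa [Matrix.det_transpose]
  have hconn : ∀ a, MatContDiffAt 1 (conn G a) (ψ y) := fun a =>
    matContDiffAt_conn hG (by norm_num) hdets.2 a
  have hconn' : ∀ a, MatContDiffAt 1 (conn G' a) y := fun a =>
    matContDiffAt_conn hG' (by norm_num) hdet' a
  have hgauge : ∀ a, ∀ᶠ z in 𝓝 y, jacobian ψ z * conn G' a z
      = pullbackConn ψ (conn G) a z * jacobian ψ z + mpderiv a (jacobian ψ) z := by
    intro a
    have e1 : ∀ᶠ z in 𝓝 y, ContDiffAt ℝ 2 ψ z := hψ2.eventually (by decide)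
    have e2 : ∀ᶠ z in 𝓝 y, MatContDiffAt 1 G (ψ z) :=
      hψ.continuousAt.eventually ((hG.of_le one_le_two).eventually (by decide))
    have e3 : ∀ᶠ z in 𝓝 y, (G' z).det ≠ 0 := hG'.det.continuousAt.eventually_ne hdet'
    filter_upwards [e1, e2, e3, h.eventually_nhds] with z h1 h2 h3 h4
    exact jacobian_mul_conn hs hs' h1 h2 h3 h4 a
  have hF := curv_gauge hJ hconn' (matContDiffAt_pullbackConn hψ2 hconn) hgauge
  have hric : (Matrix.of fun a b => ricci G' a b y)
      = P.transpose * ((Matrix.of fun a b => ricci G a b (ψ y)) * P) := by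
    ext a b
    have hF' : ∀ c, curv (conn G') c b y
        = ∑ i, ∑ j, (P i c * P j b) • (P⁻¹ * (curv (conn G) i j (ψ y) * P)) := by
      intro c
      rw [← Matrix.nonsing_inv_mul_cancel_left P (curv (conn G') c b y) hu, hF c b,
        curv_pullbackConn hψ2 hconn]
      simp only [Finset.sum_mul, Finset.mul_sum, Matrix.smul_mul, Matrix.mul_smul, ← hP]
    -- The contraction that defines Ricci pairs the upper index of `P⁻¹` with `P`, so the
    -- conjugation disappears and Ricci transforms as a bilinear form.
    have hcontr : ∀ i j, ∑ c, P i c * (P⁻¹ * (curv (conn G) i j (ψ y) * P)) c a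
        = (curv (conn G) i j (ψ y) * P) i a := by
      intro i j
      rw [← Matrix.mul_apply, Matrix.mul_nonsing_inv_cancel_left _ _ hu]
    rw [Matrix.of_apply, ricci_eq_curv hs']
    simp only [hF', Matrix.sum_apply, Matrix.smul_apply, smul_eq_mul]
    calc _ = ∑ i, ∑ j, P j b * ∑ c, P i c * (P⁻¹ * (curv (conn G) i j (ψ y) * P)) c a := by
          rw [Finset.sum_comm]
          refine Finset.sum_congr rfl fun i _ => ?_
          rw [Finset.sum_comm]
          refine Finset.sum_congr rfl fun j _ => ?_
          rw [Finset.mul_sum]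
          exact Finset.sum_congr rfl fun c _ => by ring
      _ = _ := by
          simp only [hcontr]
          simp only [Matrix.mul_apply, Matrix.transpose_apply, Matrix.of_apply,
            ricci_eq_curv hs, Finset.mul_sum, Finset.sum_mul]
          rw [Finset.sum_congr rfl fun i _ => Finset.sum_comm, Finset.sum_comm]
          refine Finset.sum_congr rfl fun d _ => ?_
          rw [Finset.sum_comm]
          exact Finset.sum_congr rfl fun j _ => Finset.sum_congr rfl fun i _ => by ring
  -- The inverse metric transforms by the inverse factors, which cancel those of Ricci under the
  -- cyclic trace.
  have hinv : (G' y)⁻¹ = P⁻¹ * ((G (ψ y))⁻¹ * P.transpose⁻¹) := by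
    rw [hy, Matrix.mul_inv_rev, Matrix.mul_inv_rev, mul_assoc]
  rw [coordScalar_eq_trace, coordScalar_eq_trace, hric, hinv]
  simp only [Matrix.transpose_mul, Matrix.transpose_transpose]
  have e2 : ∀ X : Matrix (Fin n) (Fin n) ℝ, P.transpose⁻¹ * (P.transpose * X) = X := fun X =>
    Matrix.nonsing_inv_mul_cancel_left _ _ huT
  simp only [mul_assoc, e2]
  rw [Matrix.trace_mul_comm]
  simp only [mul_assoc, Matrix.mul_nonsing_inv _ hu, mul_one]

end Connection

/-! ### Conformal changes of the metric in coordinates -/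

section Conformal

variable {n : ℕ} {G : EuclideanSpace ℝ (Fin n) → Matrix (Fin n) (Fin n) ℝ}
  {φ : EuclideanSpace ℝ (Fin n) → ℝ} {y : EuclideanSpace ℝ (Fin n)}

theorem coordScalar_congr {G' : EuclideanSpace ℝ (Fin n) → Matrix (Fin n) (Fin n) ℝ}
    (h : G =ᶠ[𝓝 y] G') : coordScalar G y = coordScalar G' y := by
  have hc : ∀ c a b, christoffel G c a b =ᶠ[𝓝 y] christoffel G' c a b := by
    intro c a b
    filter_upwards [h.eventuallyEq_nhds] with z hz
    have hp : ∀ i j k, pderiv i (fun z => G z j k) z = pderiv i (fun z => G' z j k) z :=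
      fun i j k => pderiv_congr (hz.mono fun w hw => by simp only [hw]) i
    simp only [christoffel, hz.self_of_nhds, hp]
  have hr : ∀ a b, ricci G a b y = ricci G' a b y := by
    intro a b
    simp only [ricci, (hc _ _ _).self_of_nhds, pderiv_congr (hc _ _ _)]
  simp only [coordScalar, hr, h.self_of_nhds]

/-- The gradient `V^c = ∑_d G^{cd} ∂_d φ`. -/
def grad (G : EuclideanSpace ℝ (Fin n) → Matrix (Fin n) (Fin n) ℝ)
    (φ : EuclideanSpace ℝ (Fin n) → ℝ) (c : Fin n) (y : EuclideanSpace ℝ (Fin n)) : ℝ :=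
  ∑ d, (G y)⁻¹ c d * pderiv d φ y

/-- The squared norm `|dφ|²`. -/
def gradSq (G : EuclideanSpace ℝ (Fin n) → Matrix (Fin n) (Fin n) ℝ)
    (φ : EuclideanSpace ℝ (Fin n) → ℝ) (y : EuclideanSpace ℝ (Fin n)) : ℝ :=
  ∑ c, pderiv c φ y * grad G φ c y

/-- The Laplacian `∑_c (∂_c V^c + ∑_a Γ^a_{ca} V^c)`, where `V` is the gradient. -/
def laplacian (G : EuclideanSpace ℝ (Fin n) → Matrix (Fin n) (Fin n) ℝ)
    (φ : EuclideanSpace ℝ (Fin n) → ℝ) (y : EuclideanSpace ℝ (Fin n)) : ℝ :=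
  ∑ c, pderiv c (grad G φ c) y + ∑ c, (conn G c y).trace * grad G φ c y

theorem sum_metric_mul_grad (hdet : (G y).det ≠ 0) (a : Fin n) :
    ∑ c, G y a c * grad G φ c y = pderiv a φ y := by
  have : (fun c => grad G φ c y) = (G y)⁻¹.mulVec fun d => pderiv d φ y := rfl
  change (G y).mulVec (fun c => grad G φ c y) a = _
  rw [this, Matrix.mulVec_mulVec, Matrix.mul_nonsing_inv _ (isUnit_iff_ne_zero.2 hdet),
    Matrix.one_mulVec]

/-- The change of the Christoffel symbols under a conformal change with factor `e^{2φ}`. -/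
def confTensor (G : EuclideanSpace ℝ (Fin n) → Matrix (Fin n) (Fin n) ℝ)
    (φ : EuclideanSpace ℝ (Fin n) → ℝ) (c a b : Fin n) (y : EuclideanSpace ℝ (Fin n)) : ℝ :=
  (if c = a then pderiv b φ y else 0) + (if c = b then pderiv a φ y else 0)
    - G y a b * grad G φ c y

theorem confTensor_symm (hs : ∀ z, (G z).IsSymm) (c a b : Fin n) :
    confTensor G φ c a b y = confTensor G φ c b a y := by
  rw [confTensor, confTensor, (hs y).apply a b]
  ring

theorem sum_mul_confTensor (T : Fin n → ℝ) (a b : Fin n) :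
    ∑ d, T d * confTensor G φ d a b y
      = T a * pderiv b φ y + T b * pderiv a φ y - G y a b * ∑ d, T d * grad G φ d y := by
  simp only [confTensor, mul_sub, mul_add, mul_ite, mul_zero, Finset.sum_sub_distrib,
    Finset.sum_add_distrib, Finset.sum_ite_eq', Finset.mem_univ, if_true, Finset.mul_sum]
  congr 1
  exact Finset.sum_congr rfl fun d _ => by ring

theorem sum_confTensor_self (hdet : (G y).det ≠ 0) (a : Fin n) :
    ∑ c, confTensor G φ c a c y = n * pderiv a φ y := by
  simp only [confTensor, if_true, Finset.sum_sub_distrib, Finset.sum_add_distrib,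
    Finset.sum_ite_eq', Finset.mem_univ, Finset.sum_const, Finset.card_univ, Fintype.card_fin,
    nsmul_eq_mul, sum_metric_mul_grad hdet]
  ring

/-- Uniqueness of the Levi-Civita connection again: the correction `S` is symmetric in its lower
indices, and `S_cᵀ G + G S_c = 2 (∂_c φ) G` is exactly the extra derivative of `e^{2φ}`. -/
theorem christoffel_conformal (hs : ∀ z, (G z).IsSymm) (hdet : (G y).det ≠ 0)
    (hG : MatContDiffAt 1 G y) (hφ : ContDiffAt ℝ 1 φ y) (c a b : Fin n) :
    christoffel (fun z => Real.exp (2 * φ z) • G z) c a b y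
      = christoffel G c a b y + confTensor G φ c a b y := by
  have hs' : ∀ z, (Real.exp (2 * φ z) • G z).IsSymm := fun z => by
    rw [Matrix.IsSymm, Matrix.transpose_smul, hs z]
  have hdet' : (Real.exp (2 * φ y) • G y).det ≠ 0 := by
    rw [Matrix.det_smul]
    exact mul_ne_zero (pow_ne_zero _ (Real.exp_pos _).ne') hdet
  have hφd := hφ.differentiableAt one_ne_zero
  refine congrFun (congrFun (conn_unique (G := fun z => Real.exp (2 * φ z) • G z) hs' hdet'
    (fun a => conn G a y + Matrix.of fun c b => confTensor G φ c a b y) ?_ ?_ a) c) b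
  · intro a b c
    simp only [Matrix.add_apply, Matrix.of_apply]
    rw [conn_symm hs, confTensor_symm hs]
  · intro c
    have hm := mpderiv_eq_conn hs hdet c
    have hS : ∀ c a b, (G y * Matrix.of fun d b => confTensor G φ d c b y) a b
        = G y a c * pderiv b φ y + G y a b * pderiv c φ y - G y c b * pderiv a φ y := by
      intro c a b
      simp only [Matrix.mul_apply, Matrix.of_apply]
      rw [sum_mul_confTensor, sum_metric_mul_grad hdet]
    have hT : (Matrix.of fun d b => confTensor G φ d c b y).transpose * G y
        = (G y * Matrix.of fun d b => confTensor G φ d c b y).transpose := by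
      rw [Matrix.transpose_mul, hs y]
    have hsum : (Matrix.of fun d b => confTensor G φ d c b y).transpose * G y
        + G y * (Matrix.of fun d b => confTensor G φ d c b y) = (2 * pderiv c φ y) • G y := by
      rw [hT]
      ext a b
      rw [Matrix.add_apply, Matrix.transpose_apply, hS, hS, Matrix.smul_apply, smul_eq_mul,
        (hs y).apply a b, (hs y).apply a c, (hs y).apply b c]
      ring
    have hl : mpderiv c (fun z => Real.exp (2 * φ z) • G z) y
        = Real.exp (2 * φ y) • ((2 * pderiv c φ y) • G y + mpderiv c G y) := by
      ext a b
      simp only [mpderiv_apply, Matrix.smul_apply, Matrix.add_apply, smul_eq_mul]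
      have he : DifferentiableAt ℝ (fun z => Real.exp (2 * φ z)) y :=
        (hφd.const_mul 2).exp
      rw [pderiv_mul he (hG.differentiableAt one_ne_zero a b),
        pderiv_scomp (f := fun z => 2 * φ z) (Real.hasDerivAt_exp _) (hφd.const_mul 2),
        pderiv_const_mul hφd]
      ring
    rw [hl, ← hsum, hm]
    simp only [Matrix.transpose_add, Matrix.mul_smul, Matrix.smul_mul, add_mul, mul_add, smul_add]
    abel

theorem contDiffAt_grad (hdet : (G y).det ≠ 0) (hG : MatContDiffAt 1 G y)
    (hφ : ContDiffAt ℝ 2 φ y) (c : Fin n) : ContDiffAt ℝ 1 (grad G φ c) y :=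
  ContDiffAt.sum fun d _ => (hG.inv hdet c d).mul (contDiffAt_pderiv hφ (by norm_num) d)

/-- The divergence of the gradient is the trace of the Hessian because `G⁻¹` is parallel. The
identity `hdH`, from differentiating `G G⁻¹ = 1`, yields two terms: one cancels the trace of the
connection and the other is the Christoffel part of the Hessian. -/
theorem laplacian_eq (hs : ∀ z, (G z).IsSymm) (hdet : (G y).det ≠ 0)
    (hG : MatContDiffAt 1 G y) (hφ : ContDiffAt ℝ 2 φ y) :
    laplacian G φ y = ∑ a, ∑ b, (G y)⁻¹ a b *
      (pderiv a (pderiv b φ) y - ∑ c, christoffel G c a b y * pderiv c φ y) := by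
  have hu := isUnit_iff_ne_zero.2 hdet
  have hH := hG.inv hdet
  have hdH : ∀ c, mpderiv c (fun z => (G z)⁻¹) y
      = -((G y)⁻¹ * (conn G c y).transpose + conn G c y * (G y)⁻¹) := by
    intro c
    have h0 : mpderiv c (fun z => G z * (G z)⁻¹) y = 0 := by
      have : (fun z => G z * (G z)⁻¹) =ᶠ[𝓝 y] fun _ => 1 := by
        filter_upwards [hG.det.continuousAt.eventually_ne hdet] with z hz
        exact Matrix.mul_nonsing_inv _ (isUnit_iff_ne_zero.2 hz)
      rw [mpderiv_congr this]
      ext a b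
      simp
    rw [mpderiv_mul hG hH, mpderiv_eq_conn hs hdet] at h0
    have h1 : (G y)⁻¹ * (((conn G c y).transpose * G y + G y * conn G c y) * (G y)⁻¹
        + G y * mpderiv c (fun z => (G z)⁻¹) y) = 0 := by rw [h0, mul_zero]
    rw [mul_add, Matrix.nonsing_inv_mul_cancel_left _ _ hu, add_mul, mul_add, mul_assoc,
      Matrix.mul_nonsing_inv _ hu, mul_one, mul_assoc, Matrix.nonsing_inv_mul_cancel_left _ _ hu]
      at h1
    rw [eq_neg_iff_add_eq_zero, add_comm, h1]
  have hdV : ∀ c, pderiv c (grad G φ c) y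
      = ∑ d, (mpderiv c (fun z => (G z)⁻¹) y c d * pderiv d φ y
        + (G y)⁻¹ c d * pderiv c (pderiv d φ) y) := by
    intro c
    have h1 := fun d => hH.differentiableAt one_ne_zero c d
    have h2 := fun d => (contDiffAt_pderiv hφ (m := 1) (by norm_num) d).differentiableAt one_ne_zero
    have := pderiv_sum (s := Finset.univ) (fun d _ => (h1 d).fun_mul (h2 d)) c
    refine this.trans (Finset.sum_congr rfl fun d _ => ?_)
    rw [pderiv_mul (h1 d) (h2 d), mpderiv_apply]
  simp only [laplacian, hdV, hdH, Matrix.neg_apply, Matrix.add_apply, neg_mul, add_mul, mul_sub,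
    Finset.sum_add_distrib, Finset.sum_sub_distrib, neg_add, Finset.sum_neg_distrib]
  have e1 : ∑ c, ∑ d, (conn G c y * (G y)⁻¹) c d * pderiv d φ y
      = ∑ c, (conn G c y).trace * grad G φ c y := by
    simp only [Matrix.mul_apply, Matrix.trace, Matrix.diag_apply, grad, Finset.sum_mul,
      Finset.mul_sum]
    rw [Finset.sum_congr rfl fun c _ => Finset.sum_comm, Finset.sum_comm]
    refine Finset.sum_congr rfl fun e _ => Finset.sum_comm.trans ?_
    refine Finset.sum_congr rfl fun c _ => Finset.sum_congr rfl fun d _ => ?_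
    rw [conn_symm hs d e d, mul_assoc]
  have e2 : ∑ c, ∑ d, ((G y)⁻¹ * (conn G c y).transpose) c d * pderiv d φ y
      = ∑ a, ∑ b, (G y)⁻¹ a b * ∑ c, christoffel G c a b y * pderiv c φ y := by
    simp only [Matrix.mul_apply, Matrix.transpose_apply, Finset.sum_mul, Finset.mul_sum]
    refine Finset.sum_congr rfl fun c _ => ?_
    rw [Finset.sum_comm]
    refine Finset.sum_congr rfl fun e _ => Finset.sum_congr rfl fun d _ => ?_
    rw [mul_assoc]
    rfl
  rw [e1, e2]
  ring

/-- Insert `Γ + S` into Ricci. Derivatives of `S` and the products `Γ S` assemble into the Hessian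
and the Laplacian, while `S S` gives the terms quadratic in `dφ`. The remaining terms, products of
the gradient with `∂G` or with `G Γ`, cancel by metric compatibility (`hcompat`). -/
theorem ricci_conformal (hs : ∀ z, (G z).IsSymm) (hdet : (G y).det ≠ 0)
    (hG : MatContDiffAt 2 G y) (hφ : ContDiffAt ℝ 2 φ y) (a b : Fin n) :
    ricci (fun z => Real.exp (2 * φ z) • G z) a b y
      = ricci G a b y
        + (2 - n) * (pderiv a (pderiv b φ) y - ∑ c, christoffel G c a b y * pderiv c φ y)
        - G y a b * laplacian G φ y + (n - 2) * (pderiv a φ y * pderiv b φ y)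
        - (n - 2) * (G y a b * gradSq G φ y) := by
  have hG1 := hG.of_le one_le_two
  have hφ1 : ContDiffAt ℝ 1 φ y := hφ.of_le one_le_two
  have hΓ : ∀ c a b, christoffel (fun z => Real.exp (2 * φ z) • G z) c a b =ᶠ[𝓝 y]
      fun z => christoffel G c a b z + confTensor G φ c a b z := by
    intro c a b
    filter_upwards [hG1.eventually (by decide), hφ1.eventually (by decide),
      hG.det.continuousAt.eventually_ne hdet] with z h1 h2 h3
    exact christoffel_conformal hs h3 h1 h2 c a b
  have hΓd : ∀ c a b, DifferentiableAt ℝ (christoffel G c a b) y := fun c a b =>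
    (matContDiffAt_conn hG (m := 1) (by norm_num) hdet a).differentiableAt one_ne_zero c b
  have hVd : ∀ c, DifferentiableAt ℝ (grad G φ c) y := fun c =>
    (contDiffAt_grad hdet hG1 hφ c).differentiableAt one_ne_zero
  have hφd : ∀ c, DifferentiableAt ℝ (pderiv c φ) y := fun c =>
    (contDiffAt_pderiv hφ (m := 1) (by norm_num) c).differentiableAt one_ne_zero
  have hGd : ∀ a b, DifferentiableAt ℝ (fun z => G z a b) y := hG1.differentiableAt one_ne_zero
  have hif : ∀ (p : Prop) [Decidable p] (c : Fin n),
      DifferentiableAt ℝ (fun z => if p then pderiv c φ z else 0) y := by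
    intro p _ c
    split_ifs
    exacts [hφd c, differentiableAt_const _]
  have hifd : ∀ (p : Prop) [Decidable p] (c e : Fin n),
      pderiv e (fun z => if p then pderiv c φ z else 0) y
        = if p then pderiv e (pderiv c φ) y else 0 := by
    intro p _ c e
    split_ifs
    exacts [rfl, pderiv_const _ _]
  have hSd : ∀ c a b, DifferentiableAt ℝ (confTensor G φ c a b) y := fun c a b =>
    ((hif _ _).fun_add (hif _ _)).fun_sub ((hGd a b).fun_mul (hVd c))
  have hdS : ∀ e c a b, pderiv e (confTensor G φ c a b) y
      = (if c = a then pderiv e (pderiv b φ) y else 0)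
        + (if c = b then pderiv e (pderiv a φ) y else 0)
        - (pderiv e (fun z => G z a b) y * grad G φ c y + G y a b * pderiv e (grad G φ c) y) := by
    intro e c a b
    have := pderiv_sub ((hif (c = a) b).fun_add (hif (c = b) a)) ((hGd a b).fun_mul (hVd c)) e
    rw [pderiv_add (hif (c = a) b) (hif (c = b) a), hifd, hifd, pderiv_mul (hGd a b) (hVd c)]
      at this
    exact this
  have hcomm : pderiv b (pderiv a φ) y = pderiv a (pderiv b φ) y := pderiv_comm hφ b a
  have hdΓ : ∀ e c a b, pderiv e (christoffel (fun z => Real.exp (2 * φ z) • G z) c a b) y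
      = pderiv e (christoffel G c a b) y + pderiv e (confTensor G φ c a b) y := fun e c a b => by
    rw [pderiv_congr (hΓ c a b), pderiv_add (hΓd c a b) (hSd c a b)]
  -- the terms linear in the derivatives of the tensor
  have hlin1 : ∑ c, pderiv c (confTensor G φ c a b) y
      = 2 * pderiv a (pderiv b φ) y - ∑ c, pderiv c (fun z => G z a b) y * grad G φ c y
        - G y a b * ∑ c, pderiv c (grad G φ c) y := by
    simp only [hdS, Finset.sum_sub_distrib, Finset.sum_add_distrib, Finset.sum_ite_eq',
      Finset.mem_univ, if_true, Finset.mul_sum, hcomm]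
    ring
  have hlin2 : ∑ c, pderiv b (confTensor G φ c a c) y = n * pderiv a (pderiv b φ) y := by
    rw [← pderiv_sum fun c _ => hSd c a c]
    have : (fun z => ∑ c, confTensor G φ c a c z) =ᶠ[𝓝 y] fun z => n * pderiv a φ z := by
      filter_upwards [hG.det.continuousAt.eventually_ne hdet] with z hz
      exact sum_confTensor_self hz a
    rw [pderiv_congr this, pderiv_const_mul (hφd a), hcomm]
  -- the quadratic terms
  have hS0 : ∀ a, ∑ c, confTensor G φ c c a y = n * pderiv a φ y := fun a => by
    rw [← sum_confTensor_self hdet]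
    exact Finset.sum_congr rfl fun c _ => confTensor_symm hs c c a
  -- The tensor `T` is left free because the same contraction serves for `Γ S` (`hq4`, `hq5`) and
  -- for `S S` (`hq6`).
  have hcontr : ∀ (T : Fin n → Fin n → Fin n → ℝ) (a b : Fin n),
      ∑ c, ∑ d, T c b d * confTensor G φ d a c y
        = ∑ c, T c b a * pderiv c φ y + (∑ c, T c b c) * pderiv a φ y
          - ∑ c, ∑ d, G y a c * (T c b d * grad G φ d y) := by
    intro T a b
    simp only [sum_mul_confTensor, Finset.sum_sub_distrib, Finset.sum_add_distrib, Finset.sum_mul,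
      Finset.mul_sum]
  have hq1 : ∑ c, ∑ d, christoffel G c c d y * confTensor G φ d a b y
      = (∑ c, christoffel G c a c y) * pderiv b φ y + (∑ c, christoffel G c b c y) * pderiv a φ y
        - G y a b * ∑ d, (conn G d y).trace * grad G φ d y := by
    rw [Finset.sum_comm]
    simp only [← Finset.sum_mul]
    rw [sum_mul_confTensor]
    have ht : ∀ d, ∑ c, christoffel G c c d y = (conn G d y).trace := fun d =>
      Finset.sum_congr rfl fun c _ => congrFun (christoffel_symm hs c c d) y
    have ht' : ∀ d, ∑ c, christoffel G c d c y = (conn G d y).trace := fun d => rfl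
    simp only [ht, ht']
  have hq2 : ∑ c, ∑ d, confTensor G φ c c d y * christoffel G d a b y
      = n * ∑ d, christoffel G d a b y * pderiv d φ y := by
    rw [Finset.sum_comm, Finset.mul_sum]
    refine Finset.sum_congr rfl fun d _ => ?_
    rw [← Finset.sum_mul, hS0]
    ring
  have hq3 : ∑ c, ∑ d, confTensor G φ c c d y * confTensor G φ d a b y
      = 2 * n * (pderiv a φ y * pderiv b φ y) - n * (G y a b * gradSq G φ y) := by
    rw [Finset.sum_comm]
    simp only [← Finset.sum_mul, hS0]
    rw [sum_mul_confTensor, gradSq]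
    simp only [Finset.mul_sum, mul_assoc]
    rw [← sub_eq_zero]
    have : ∀ x, G y a b * (n * (pderiv x φ y * grad G φ x y))
      = n * (G y a b * (pderiv x φ y * grad G φ x y)) := fun x => by ring
    simp only [this]
    ring
  have hq4 := hcontr (fun c b d => christoffel G c b d y) a b
  have hq5 : ∑ c, ∑ d, confTensor G φ c b d y * christoffel G d a c y
      = ∑ c, christoffel G c a b y * pderiv c φ y + (∑ c, christoffel G c a c y) * pderiv b φ y
          - ∑ c, ∑ d, G y b c * (christoffel G c a d y * grad G φ d y) := by
    rw [← hcontr (fun c b d => christoffel G c b d y) b a, Finset.sum_comm]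
    exact Finset.sum_congr rfl fun d _ => Finset.sum_congr rfl fun c _ => by ring
  have hq6 : ∑ c, ∑ d, confTensor G φ c b d y * confTensor G φ d a c y
      = (n + 2) * (pderiv a φ y * pderiv b φ y) - 2 * (G y a b * gradSq G φ y) := by
    rw [hcontr (fun c b d => confTensor G φ c b d y) a b, sum_confTensor_self hdet]
    have h1 : ∑ c, confTensor G φ c b a y * pderiv c φ y
        = 2 * (pderiv a φ y * pderiv b φ y) - G y a b * gradSq G φ y := by
      simp only [mul_comm (confTensor G φ _ b a y)]
      rw [sum_mul_confTensor, (hs y).apply a b, gradSq]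
      ring
    have h2 : ∑ c, ∑ d, G y a c * (confTensor G φ c b d y * grad G φ d y)
        = G y a b * gradSq G φ y := by
      rw [Finset.sum_comm]
      simp only [← mul_assoc, ← Finset.sum_mul, sum_mul_confTensor, sum_metric_mul_grad hdet]
      have h3 : ∑ d, G y b d * pderiv a φ y * grad G φ d y = pderiv b φ y * pderiv a φ y := by
        rw [← sum_metric_mul_grad (φ := φ) hdet b, Finset.sum_mul]
        exact Finset.sum_congr rfl fun d _ => by ring
      have h4 : ∑ d, G y a d * pderiv b φ y * grad G φ d y = pderiv a φ y * pderiv b φ y := by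
        rw [← sum_metric_mul_grad (φ := φ) hdet a, Finset.sum_mul]
        exact Finset.sum_congr rfl fun d _ => by ring
      simp only [sub_mul, add_mul, Finset.sum_sub_distrib, Finset.sum_add_distrib]
      rw [h3, h4, gradSq, Finset.mul_sum]
      simp only [mul_assoc]
      ring
    rw [h1, h2]
    ring
  -- compatibility of the connection with the metric
  have hcompat : ∑ c, pderiv c (fun z => G z a b) y * grad G φ c y
      = ∑ c, ∑ d, G y a c * (christoffel G c b d y * grad G φ d y)
        + ∑ c, ∑ d, G y b c * (christoffel G c a d y * grad G φ d y) := by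
    have hm : ∀ d, pderiv d (fun z => G z a b) y
        = ∑ c, (G y b c * christoffel G c a d y + G y a c * christoffel G c b d y) := by
      intro d
      have := congrFun (congrFun (mpderiv_eq_conn hs hdet d) a) b
      simp only [Matrix.add_apply, Matrix.mul_apply, Matrix.transpose_apply, mpderiv_apply] at this
      rw [this, ← Finset.sum_add_distrib]
      refine Finset.sum_congr rfl fun c _ => ?_
      rw [conn_symm hs d a c, conn_symm hs d b c, (hs y).apply b c, mul_comm]
      rfl
    simp only [hm, Finset.sum_mul, add_mul, Finset.sum_add_distrib, mul_assoc]
    rw [Finset.sum_comm, add_comm, Finset.sum_comm]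
  have hquad : ∀ c d,
      christoffel (fun z => Real.exp (2 * φ z) • G z) c c d y
          * christoffel (fun z => Real.exp (2 * φ z) • G z) d a b y
        - christoffel (fun z => Real.exp (2 * φ z) • G z) c b d y
          * christoffel (fun z => Real.exp (2 * φ z) • G z) d a c y
      = (christoffel G c c d y * christoffel G d a b y
          - christoffel G c b d y * christoffel G d a c y)
        + (christoffel G c c d y * confTensor G φ d a b y
          + confTensor G φ c c d y * christoffel G d a b y
          + confTensor G φ c c d y * confTensor G φ d a b y
          - christoffel G c b d y * confTensor G φ d a c y
          - confTensor G φ c b d y * christoffel G d a c y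
          - confTensor G φ c b d y * confTensor G φ d a c y) := by
    intro c d
    simp only [(hΓ _ _ _).self_of_nhds]
    ring
  have hdiff : ∀ c, pderiv c (christoffel (fun z => Real.exp (2 * φ z) • G z) c a b) y
        - pderiv b (christoffel (fun z => Real.exp (2 * φ z) • G z) c a c) y
      = (pderiv c (christoffel G c a b) y - pderiv b (christoffel G c a c) y)
        + (pderiv c (confTensor G φ c a b) y - pderiv b (confTensor G φ c a c) y) := by
    intro c
    rw [hdΓ, hdΓ]
    ring
  rw [ricci, ricci, Finset.sum_congr rfl fun c _ => hdiff c,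
    Finset.sum_congr rfl fun c _ => Finset.sum_congr rfl fun d _ => hquad c d]
  simp only [Finset.sum_add_distrib (f := fun c => pderiv c (christoffel G c a b) y
    - pderiv b (christoffel G c a c) y)]
  have hsplit : ∑ c, ∑ d, ((christoffel G c c d y * christoffel G d a b y
          - christoffel G c b d y * christoffel G d a c y)
        + (christoffel G c c d y * confTensor G φ d a b y
          + confTensor G φ c c d y * christoffel G d a b y
          + confTensor G φ c c d y * confTensor G φ d a b y
          - christoffel G c b d y * confTensor G φ d a c y
          - confTensor G φ c b d y * christoffel G d a c y
          - confTensor G φ c b d y * confTensor G φ d a c y))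
      = ∑ c, ∑ d, (christoffel G c c d y * christoffel G d a b y
          - christoffel G c b d y * christoffel G d a c y)
        + (∑ c, ∑ d, christoffel G c c d y * confTensor G φ d a b y
          + ∑ c, ∑ d, confTensor G φ c c d y * christoffel G d a b y
          + ∑ c, ∑ d, confTensor G φ c c d y * confTensor G φ d a b y
          - ∑ c, ∑ d, christoffel G c b d y * confTensor G φ d a c y
          - ∑ c, ∑ d, confTensor G φ c b d y * christoffel G d a c y
          - ∑ c, ∑ d, confTensor G φ c b d y * confTensor G φ d a c y) := by
    simp only [Finset.sum_add_distrib, Finset.sum_sub_distrib]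
  have hba : ∑ c, christoffel G c b a y * pderiv c φ y
      = ∑ c, christoffel G c a b y * pderiv c φ y :=
    Finset.sum_congr rfl fun c _ => by rw [christoffel_symm hs c b a]
  rw [hsplit, hq1, hq2, hq3, hq4, hq5, hq6, hba, Finset.sum_sub_distrib (f := fun c =>
    pderiv c (confTensor G φ c a b) y), hlin1, hlin2, hcompat, laplacian]
  ring

/-- Trace of the Ricci formula. Since `G⁻¹` contracted with `G` is `n`, the Laplacian gets `(2 - n)
- n` and the squared gradient gets `(n - 2) - n (n - 2)`. -/
theorem coordScalar_conformal (hs : ∀ z, (G z).IsSymm) (hdet : (G y).det ≠ 0)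
    (hG : MatContDiffAt 2 G y) (hφ : ContDiffAt ℝ 2 φ y) :
    coordScalar (fun z => Real.exp (2 * φ z) • G z) y
      = Real.exp (-(2 * φ y)) * (coordScalar G y - 2 * (n - 1) * laplacian G φ y
        - (n - 1) * (n - 2) * gradSq G φ y) := by
  have hu := isUnit_iff_ne_zero.2 hdet
  have hinv : (Real.exp (2 * φ y) • G y)⁻¹ = Real.exp (-(2 * φ y)) • (G y)⁻¹ := by
    refine Matrix.inv_eq_right_inv ?_
    rw [Matrix.smul_mul, Matrix.mul_smul, smul_smul, ← Real.exp_add, add_neg_cancel, Real.exp_zero,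
      one_smul, Matrix.mul_nonsing_inv _ hu]
  have htr : ∑ a, ∑ b, (G y)⁻¹ a b * G y a b = n := by
    have : ((G y)⁻¹ * (G y).transpose).trace = n := by
      rw [hs y, Matrix.nonsing_inv_mul _ hu, Matrix.trace_one, Fintype.card_fin]
    rw [← this]
    simp [Matrix.trace, Matrix.mul_apply]
  have hsq : ∑ a, ∑ b, (G y)⁻¹ a b * (pderiv a φ y * pderiv b φ y) = gradSq G φ y := by
    simp only [gradSq, grad, Finset.mul_sum]
    exact Finset.sum_congr rfl fun a _ => Finset.sum_congr rfl fun b _ => by ring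
  have hlap := laplacian_eq hs hdet (hG.of_le one_le_two) hφ
  have key : ∀ a b, (Real.exp (-(2 * φ y)) • (G y)⁻¹) a b *
      ricci (fun z => Real.exp (2 * φ z) • G z) a b y
      = Real.exp (-(2 * φ y)) * ((G y)⁻¹ a b * ricci G a b y
        + (2 - n) * ((G y)⁻¹ a b * (pderiv a (pderiv b φ) y
            - ∑ c, christoffel G c a b y * pderiv c φ y))
        - laplacian G φ y * ((G y)⁻¹ a b * G y a b)
        + (n - 2) * ((G y)⁻¹ a b * (pderiv a φ y * pderiv b φ y))
        - (n - 2) * gradSq G φ y * ((G y)⁻¹ a b * G y a b)) := by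
    intro a b
    rw [ricci_conformal hs hdet hG hφ, Matrix.smul_apply, smul_eq_mul]
    ring
  rw [coordScalar]
  simp only [hinv, key, ← Finset.mul_sum, Finset.sum_add_distrib, Finset.sum_sub_distrib]
  rw [← hlap, htr, hsq, coordScalar]
  ring

/-! ### Volume density and the divergence identity -/

/-- The density of the Riemannian volume. -/
def volDensity (G : EuclideanSpace ℝ (Fin n) → Matrix (Fin n) (Fin n) ℝ)
    (y : EuclideanSpace ℝ (Fin n)) : ℝ :=
  Real.sqrt (G y).det

theorem contDiffAt_volDensity {k : WithTop ℕ∞} (hdet : 0 < (G y).det)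
    (hG : MatContDiffAt k G y) : ContDiffAt ℝ k (volDensity G) y :=
  hG.det.sqrt hdet.ne'

/-- Jacobi's formula gives half the trace of `G⁻¹ ∂_c G`, and compatibility splits `∂_c G` into two
terms of equal trace. This turns `laplacian` into a Euclidean divergence after multiplication by the
density. -/
theorem pderiv_volDensity (hs : ∀ z, (G z).IsSymm) (hdet : 0 < (G y).det)
    (hG : MatContDiffAt 1 G y) (c : Fin n) :
    pderiv c (volDensity G) y = volDensity G y * (conn G c y).trace := by
  have hu := isUnit_iff_ne_zero.2 hdet.ne'
  have hd : pderiv c (fun z => (G z).det) y = 2 * ((G y).det * (conn G c y).trace) := by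
    have hadj : (G y).adjugate = (G y).det • (G y)⁻¹ := by
      rw [Matrix.inv_def, smul_smul, Ring.mul_inverse_cancel _ hu, one_smul]
    rw [pderiv_det hG, hadj, mpderiv_eq_conn hs hdet.ne', Matrix.smul_mul, Matrix.trace_smul,
      mul_add, Matrix.nonsing_inv_mul_cancel_left _ _ hu, Matrix.trace_add, Matrix.trace_mul_comm,
      mul_assoc, Matrix.mul_nonsing_inv _ hu, mul_one, Matrix.trace_transpose, smul_eq_mul]
    ring
  have h1 := pderiv_scomp (f := fun z => (G z).det) (Real.hasDerivAt_sqrt hdet.ne')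
    (hG.det.differentiableAt one_ne_zero) c
  have hpos := Real.sqrt_pos.2 hdet
  change pderiv c (fun z => Real.sqrt (G z).det) y = _
  rw [h1, hd, volDensity]
  field_simp
  rw [Real.sq_sqrt hdet.le]

theorem volDensity_conformal :
    volDensity (fun z => Real.exp (2 * φ z) • G z) y = Real.exp (n * φ y) * volDensity G y := by
  have : Real.exp (2 * φ y) ^ n = Real.exp (n * φ y) ^ 2 := by
    rw [← Real.exp_nat_mul, ← Real.exp_nat_mul]
    congr 1
    push_cast
    ring
  rw [volDensity, volDensity, Matrix.det_smul, Fintype.card_fin, this,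
    Real.sqrt_mul (sq_nonneg _), Real.sqrt_sq (Real.exp_pos _).le]

/-- The flux `√(det G) e^{(n-2)φ} V^c` whose divergence appears in the conformal change of the
scalar curvature density. -/
def confFlux (G : EuclideanSpace ℝ (Fin n) → Matrix (Fin n) (Fin n) ℝ)
    (φ : EuclideanSpace ℝ (Fin n) → ℝ) (c : Fin n) (y : EuclideanSpace ℝ (Fin n)) : ℝ :=
  volDensity G y * (Real.exp ((n - 2) * φ y) * grad G φ c y)

theorem contDiffAt_confFlux (hdet : 0 < (G y).det) (hG : MatContDiffAt 1 G y)
    (hφ : ContDiffAt ℝ 2 φ y) (c : Fin n) : ContDiffAt ℝ 1 (confFlux G φ c) y :=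
  (contDiffAt_volDensity hdet hG).mul
    ((contDiffAt_const.mul (hφ.of_le one_le_two)).exp.mul (contDiffAt_grad hdet.ne' hG hφ c))

/-- In the product rule the density supplies the trace term of the Laplacian, and the exponential
supplies `(n - 2) |dφ|²`. -/
theorem sum_pderiv_confFlux (hs : ∀ z, (G z).IsSymm) (hdet : 0 < (G y).det)
    (hG : MatContDiffAt 1 G y) (hφ : ContDiffAt ℝ 2 φ y) :
    ∑ c, pderiv c (confFlux G φ c) y = volDensity G y * (Real.exp ((n - 2) * φ y)
      * (laplacian G φ y + (n - 2) * gradSq G φ y)) := by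
  have hφd := (hφ.of_le one_le_two).differentiableAt one_ne_zero
  have hv := (contDiffAt_volDensity hdet hG).differentiableAt one_ne_zero
  have he : DifferentiableAt ℝ (fun z => Real.exp ((n - 2) * φ z)) y := (hφd.const_mul _).exp
  have hV := fun c => (contDiffAt_grad hdet.ne' hG hφ c).differentiableAt one_ne_zero
  have h1 : ∀ c, pderiv c (confFlux G φ c) y = volDensity G y * (Real.exp ((n - 2) * φ y)
      * (pderiv c (grad G φ c) y + (conn G c y).trace * grad G φ c y
        + (n - 2) * (pderiv c φ y * grad G φ c y))) := by
    intro c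
    have := pderiv_mul hv (he.fun_mul (hV c)) c
    rw [pderiv_mul he (hV c), pderiv_volDensity hs hdet hG,
      pderiv_scomp (f := fun z => (n - 2) * φ z) (Real.hasDerivAt_exp _) (hφd.const_mul _),
      pderiv_const_mul hφd] at this
    refine Eq.trans this ?_
    ring
  simp only [h1, ← Finset.mul_sum, Finset.sum_add_distrib]
  rw [laplacian, gradSq]

/-- The scalar curvature density of a conformal metric, up to a divergence, is first order in the
conformal factor. -/
theorem volDensity_mul_coordScalar_conformal (hs : ∀ z, (G z).IsSymm) (hdet : 0 < (G y).det)
    (hG : MatContDiffAt 2 G y) (hφ : ContDiffAt ℝ 2 φ y) :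
    volDensity (fun z => Real.exp (2 * φ z) • G z) y
        * coordScalar (fun z => Real.exp (2 * φ z) • G z) y
      = Real.exp ((n - 2) * φ y) * (volDensity G y * coordScalar G y)
        + (n - 1) * (n - 2) * (Real.exp ((n - 2) * φ y) * (volDensity G y * gradSq G φ y))
        - 2 * (n - 1) * ∑ c, pderiv c (confFlux G φ c) y := by
  -- Absorbing the Laplacian in the flux adds `2 (n - 1) (n - 2)` to the coefficient `-(n - 1) (n -
  -- 2)` of `|dφ|²`. The resulting positive sign is the source of the jump in total curvature.
  rw [volDensity_conformal, coordScalar_conformal hs hdet.ne' hG hφ,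
    sum_pderiv_confFlux hs hdet (hG.of_le one_le_two) hφ]
  have : Real.exp (n * φ y) * Real.exp (-(2 * φ y)) = Real.exp ((n - 2) * φ y) := by
    rw [← Real.exp_add]
    congr 1
    ring
  rw [← this]
  ring

end Conformal

/-! ### Metrics in charts -/

section Charts

variable {k : ℕ∞} {n : ℕ} {M : Type*} [TopologicalSpace M]
  [ChartedSpace (EuclideanSpace ℝ (Fin n)) M] [IsManifold (𝓡 n) ∞ M]

/-- The coordinate vector field `∂_a` of the chart around `x₀`, as a function on `M`. -/
def coordField (x₀ : M) (a : Fin n) (x : M) : TangentSpace (𝓡 n) x :=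
  (trivializationAt (EuclideanSpace ℝ (Fin n)) (TangentSpace (𝓡 n)) x₀).symmL ℝ x
    (EuclideanSpace.single a (1 : ℝ))

/-- The coefficients of a metric in the chart around `x₀`, as functions on `M`. -/
def fieldCoeff (g : Metric k n M) (x₀ x : M) : Matrix (Fin n) (Fin n) ℝ :=
  Matrix.of fun a b => g.inner x (coordField x₀ a x) (coordField x₀ b x)

/-- Coefficients are defined by differentiating the inverse chart, whereas regularity of the metric
is expressed through the bundle trivialization. The two frames agree over the chart target. -/
theorem coordVector_eq {x₀ : M} {y : EuclideanSpace ℝ (Fin n)}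
    (hy : y ∈ (extChartAt (𝓡 n) x₀).target) (a : Fin n) :
    coordVector x₀ y a = coordField x₀ a ((extChartAt (𝓡 n) x₀).symm y) := by
  have hx : (extChartAt (𝓡 n) x₀).symm y ∈ (chartAt (EuclideanSpace ℝ (Fin n)) x₀).source := by
    rw [← extChartAt_source (𝓡 n)]
    exact (extChartAt (𝓡 n) x₀).map_target hy
  have h1 := TangentBundle.symmL_trivializationAt (I := 𝓡 n) (𝕜 := ℝ) hx
  have h2 := (extChartAt (𝓡 n) x₀).right_inv hy
  have h3 : (mfderiv (𝓡 n) (𝓡 n) (extChartAt (𝓡 n) x₀).symm y :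
        EuclideanSpace ℝ (Fin n) →L[ℝ] EuclideanSpace ℝ (Fin n))
      = mfderivWithin (𝓡 n) (𝓡 n) (extChartAt (𝓡 n) x₀).symm (range (𝓡 n))
        (extChartAt (𝓡 n) x₀ ((extChartAt (𝓡 n) x₀).symm y)) := by
    rw [h2, ModelWithCorners.range_eq_univ, mfderivWithin_univ]
  exact (congrArg (fun L : EuclideanSpace ℝ (Fin n) →L[ℝ] EuclideanSpace ℝ (Fin n) =>
    L (EuclideanSpace.single a 1)) (h3.trans h1.symm))

theorem coeff_eq_fieldCoeff (g : Metric k n M) {x₀ : M} {y : EuclideanSpace ℝ (Fin n)}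
    (hy : y ∈ (extChartAt (𝓡 n) x₀).target) :
    coeff g x₀ y = fieldCoeff g x₀ ((extChartAt (𝓡 n) x₀).symm y) := by
  ext a b
  simp only [coeff, fieldCoeff, Matrix.of_apply, coordVector_eq hy]

theorem coeff_isSymm (g : Metric k n M) (x₀ : M) (y : EuclideanSpace ℝ (Fin n)) :
    (coeff g x₀ y).IsSymm := by
  ext a b
  exact g.symm _ _ _

theorem contDiffAt_transition {x₀ x₁ x : M} (h₀ : x ∈ (extChartAt (𝓡 n) x₀).source)
    (h₁ : x ∈ (extChartAt (𝓡 n) x₁).source) :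
    ContDiffAt ℝ ∞ (extChartAt (𝓡 n) x₀ ∘ (extChartAt (𝓡 n) x₁).symm)
      (extChartAt (𝓡 n) x₁ x) := by
  have h' : extChartAt (𝓡 n) x₁ x ∈
      ((extChartAt (𝓡 n) x₁).symm ≫ extChartAt (𝓡 n) x₀).source := by
    rw [PartialEquiv.trans_source'', PartialEquiv.symm_symm, PartialEquiv.symm_target]
    exact mem_image_of_mem _ ⟨h₁, h₀⟩
  have := contDiffWithinAt_ext_coord_change (I := 𝓡 n) (n := ∞) x₀ x₁ h'
  rwa [ModelWithCorners.range_eq_univ, contDiffWithinAt_univ] at this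

/-- The derivative of a map in terms of its Jacobian matrix. -/
theorem fderiv_single_eq_jacobian {ψ : EuclideanSpace ℝ (Fin n) → EuclideanSpace ℝ (Fin n)}
    {y : EuclideanSpace ℝ (Fin n)} (hψ : DifferentiableAt ℝ ψ y) (a : Fin n) :
    fderiv ℝ ψ y (EuclideanSpace.single a 1)
      = ∑ c, jacobian ψ y c a • EuclideanSpace.single c (1 : ℝ) := by
  ext i
  have : fderiv ℝ (fun z => ψ z i) y
      = (EuclideanSpace.proj (𝕜 := ℝ) i : EuclideanSpace ℝ (Fin n) →L[ℝ] ℝ).comp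
        (fderiv ℝ ψ y) :=
    ((EuclideanSpace.proj (𝕜 := ℝ) i : EuclideanSpace ℝ (Fin n) →L[ℝ] ℝ).hasFDerivAt.comp y
      hψ.hasFDerivAt).fderiv
  have h2 : jacobian ψ y i a = fderiv ℝ ψ y (EuclideanSpace.single a 1) i := by
    simp [jacobian, pderiv, this]
  simp [Pi.single_apply, h2]

/-- Cocycle identity of the tangent bundle: passing from the trivialization at `x₁` to the fibre
over `x` factors through the one at `x₀`, and the first factor is the derivative of the transition
map. -/
theorem coordField_change {x₀ x₁ x : M} (h₀ : x ∈ (extChartAt (𝓡 n) x₀).source)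
    (h₁ : x ∈ (extChartAt (𝓡 n) x₁).source) (a : Fin n) :
    coordField x₁ a x = ∑ c, jacobian (extChartAt (𝓡 n) x₀ ∘ (extChartAt (𝓡 n) x₁).symm)
      (extChartAt (𝓡 n) x₁ x) c a • coordField x₀ c x := by
  have h₀' : x ∈ (chartAt (EuclideanSpace ℝ (Fin n)) x₀).source := by
    rwa [← extChartAt_source (𝓡 n)]
  have h₁' : x ∈ (chartAt (EuclideanSpace ℝ (Fin n)) x₁).source := by
    rwa [← extChartAt_source (𝓡 n)]
  have hd := (contDiffAt_transition h₀ h₁).differentiableAt (by simp)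
  set v : EuclideanSpace ℝ (Fin n) := EuclideanSpace.single a (1 : ℝ) with hv
  have h1 : tangentCoordChange (𝓡 n) x₁ x x v
      = tangentCoordChange (𝓡 n) x₀ x x (tangentCoordChange (𝓡 n) x₁ x₀ x v) :=
    (tangentCoordChange_comp ⟨⟨h₁, h₀⟩, mem_extChartAt_source x⟩).symm
  have h2 : tangentCoordChange (𝓡 n) x₁ x₀ x v
      = ∑ c, jacobian (extChartAt (𝓡 n) x₀ ∘ (extChartAt (𝓡 n) x₁).symm)
        (extChartAt (𝓡 n) x₁ x) c a • EuclideanSpace.single c (1 : ℝ) := by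
    rw [tangentCoordChange_def, ModelWithCorners.range_eq_univ, fderivWithin_univ, hv,
      fderiv_single_eq_jacobian hd]
  have h3 : ∀ (x₀ : M) (_ : x ∈ (chartAt (EuclideanSpace ℝ (Fin n)) x₀).source) (c : Fin n),
      coordField x₀ c x = tangentCoordChange (𝓡 n) x₀ x x (EuclideanSpace.single c (1 : ℝ)) :=
    fun x₀ h c => congrArg (fun L : EuclideanSpace ℝ (Fin n) →L[ℝ] EuclideanSpace ℝ (Fin n) =>
      L (EuclideanSpace.single c 1))
      (TangentBundle.symmL_trivializationAt_eq_core (I := 𝓡 n) (𝕜 := ℝ) h)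
  rw [h3 x₁ h₁', h1, h2, map_sum]
  simp only [map_smul]
  exact Finset.sum_congr rfl fun c _ => by rw [h3 x₀ h₀']; rfl

theorem fieldCoeff_change (g : Metric k n M) {x₀ x₁ x : M}
    (h₀ : x ∈ (extChartAt (𝓡 n) x₀).source) (h₁ : x ∈ (extChartAt (𝓡 n) x₁).source) :
    fieldCoeff g x₁ x = (jacobian (extChartAt (𝓡 n) x₀ ∘ (extChartAt (𝓡 n) x₁).symm)
        (extChartAt (𝓡 n) x₁ x)).transpose * (fieldCoeff g x₀ x
      * jacobian (extChartAt (𝓡 n) x₀ ∘ (extChartAt (𝓡 n) x₁).symm) (extChartAt (𝓡 n) x₁ x)) := by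
  ext a b
  simp only [fieldCoeff, Matrix.of_apply, coordField_change h₀ h₁, Matrix.mul_apply,
    Matrix.transpose_apply, map_sum, map_smul, sum_apply, smul_apply, smul_eq_mul, Finset.mul_sum]
  rw [Finset.sum_comm]
  exact Finset.sum_congr rfl fun c _ => Finset.sum_congr rfl fun d _ => by ring

/-- The quadratic form at `v` is `g(w, w)` with `w = ∑ v^a ∂_a`; a nonzero `v` gives a nonzero `w`
because the trivialization inverts the frame over its base set. -/
theorem fieldCoeff_posDef (g : Metric k n M) {x₀ x : M}
    (h₀ : x ∈ (extChartAt (𝓡 n) x₀).source) : (fieldCoeff g x₀ x).PosDef := by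
  have h₀' : x ∈ (trivializationAt (EuclideanSpace ℝ (Fin n)) (TangentSpace (𝓡 n)) x₀).baseSet := by
    rwa [TangentBundle.trivializationAt_baseSet, ← extChartAt_source (𝓡 n)]
  refine Matrix.PosDef.of_dotProduct_mulVec_pos ?_ fun v hv => ?_
  · ext a b
    exact g.symm _ _ _
  · set w : TangentSpace (𝓡 n) x := ∑ a, v a • coordField x₀ a x with hw
    have hq : star v ⬝ᵥ (fieldCoeff g x₀ x).mulVec v = g.inner x w w := by
      simp only [dotProduct, Matrix.mulVec, fieldCoeff, Matrix.of_apply, hw, map_sum, map_smul,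
        sum_apply, smul_apply, smul_eq_mul, Finset.mul_sum, star_trivial]
      rw [Finset.sum_comm]
      refine Finset.sum_congr rfl fun c _ => Finset.sum_congr rfl fun d _ => ?_
      rw [g.symm]
      ring
    rw [hq]
    refine g.pos x w fun h0 => hv ?_
    have h1 : w = (trivializationAt (EuclideanSpace ℝ (Fin n)) (TangentSpace (𝓡 n)) x₀).symmL ℝ x
        (∑ a, v a • EuclideanSpace.single a (1 : ℝ)) := by
      rw [hw, map_sum]
      simp only [map_smul]
      rfl
    have h2 := (trivializationAt (EuclideanSpace ℝ (Fin n)) (TangentSpace (𝓡 n))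
      x₀).continuousLinearMapAt_symmL h₀' (R := ℝ) (∑ a, v a • EuclideanSpace.single a (1 : ℝ))
    rw [← h1, h0, map_zero] at h2
    ext i
    have := congrArg (fun z : EuclideanSpace ℝ (Fin n) => z i) h2
    simpa [Pi.single_apply] using this.symm

theorem coeff_posDef (g : Metric k n M) {x₀ : M} {y : EuclideanSpace ℝ (Fin n)}
    (hy : y ∈ (extChartAt (𝓡 n) x₀).target) : (coeff g x₀ y).PosDef := by
  rw [coeff_eq_fieldCoeff g hy]
  exact fieldCoeff_posDef g ((extChartAt (𝓡 n) x₀).map_target hy)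

theorem contMDiffOn_fieldCoeff (g : Metric k n M) (x₀ : M) (a b : Fin n) :
    ContMDiffOn (𝓡 n) 𝓘(ℝ) k (fun x => fieldCoeff g x₀ x a b) (extChartAt (𝓡 n) x₀).source := by
  -- A `C^k` tangent bundle requires a `C^{k+1}` manifold. Smoothness suffices, including for `k =
  -- ∞`.
  have hk1 : (k : WithTop ℕ∞) + 1 ≤ ∞ := by
    have : ((k + 1 : ℕ∞) : WithTop ℕ∞) ≤ ((⊤ : ℕ∞) : WithTop ℕ∞) := WithTop.coe_le_coe.2 le_top
    exact this
  have : IsManifold (𝓡 n) ((k : WithTop ℕ∞) + 1) M := IsManifold.of_le hk1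
  have : ContMDiffVectorBundle k (EuclideanSpace ℝ (Fin n))
    (TangentSpace (𝓡 n) : M → Type _) (𝓡 n) := TangentBundle.contMDiffVectorBundle
  set e := trivializationAt (EuclideanSpace ℝ (Fin n)) (TangentSpace (𝓡 n) : M → Type _) x₀
  have hbase : e.baseSet = (extChartAt (𝓡 n) x₀).source := by
    rw [TangentBundle.trivializationAt_baseSet, ← extChartAt_source (𝓡 n)]
  have hf : ∀ a, ContMDiffOn (𝓡 n) ((𝓡 n).prod 𝓘(ℝ, EuclideanSpace ℝ (Fin n))) k
      (fun x => TotalSpace.mk' (EuclideanSpace ℝ (Fin n))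
        (E := (TangentSpace (𝓡 n) : M → Type _)) x (coordField x₀ a x)) e.baseSet := by
    intro a
    refine (e.contMDiffOn_localFrame_baseSet k (EuclideanSpace.basisFun (Fin n) ℝ).toBasis a).congr
      fun x hx => ?_
    rw [e.localFrame_apply_of_mem_baseSet _ hx]
    simp [Bundle.Trivialization.basisAt, coordField, e]
    exact e.symmL_apply hx _
  rw [← hbase]
  have h := ContMDiffOn.clm_bundle_apply₂ (F₁ := EuclideanSpace ℝ (Fin n))
    (F₂ := EuclideanSpace ℝ (Fin n)) (F₃ := ℝ) (E₃ := Bundle.Trivial M ℝ)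
    (g.contMDiff.contMDiffOn (s := e.baseSet)) (hf a) (hf b)
  intro x hx
  have hx' := h x hx
  simp only [contMDiffWithinAt_totalSpace] at hx'
  exact hx'.2

theorem matContDiffAt_coeff (g : Metric k n M) {x₀ : M} {y : EuclideanSpace ℝ (Fin n)}
    (hy : y ∈ (extChartAt (𝓡 n) x₀).target) : MatContDiffAt k (coeff g x₀) y := by
  intro a b
  have h1 : ContMDiffOn (𝓡 n) 𝓘(ℝ) k
      ((fun x => fieldCoeff g x₀ x a b) ∘ (extChartAt (𝓡 n) x₀).symm)
      (extChartAt (𝓡 n) x₀).target :=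
    (contMDiffOn_fieldCoeff g x₀ a b).comp
      ((contMDiffOn_extChartAt_symm (n := ∞) x₀).of_le (WithTop.coe_le_coe.2 le_top))
      fun z hz => (extChartAt (𝓡 n) x₀).map_target hz
  have h2 := (h1.contDiffOn.contDiffAt ((isOpen_extChartAt_target x₀).mem_nhds hy))
  refine h2.congr_of_eventuallyEq ?_
  filter_upwards [(isOpen_extChartAt_target x₀).mem_nhds hy] with z hz
  rw [coeff_eq_fieldCoeff g hz]
  rfl

theorem coeff_change (g : Metric k n M) {x₀ x₁ x : M}
    (h₀ : x ∈ (extChartAt (𝓡 n) x₀).source) (h₁ : x ∈ (extChartAt (𝓡 n) x₁).source) :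
    ∀ᶠ z in 𝓝 (extChartAt (𝓡 n) x₁ x), coeff g x₁ z
      = (jacobian (extChartAt (𝓡 n) x₀ ∘ (extChartAt (𝓡 n) x₁).symm) z).transpose
        * (coeff g x₀ ((extChartAt (𝓡 n) x₀ ∘ (extChartAt (𝓡 n) x₁).symm) z)
          * jacobian (extChartAt (𝓡 n) x₀ ∘ (extChartAt (𝓡 n) x₁).symm) z) := by
  have ht : extChartAt (𝓡 n) x₁ x ∈ (extChartAt (𝓡 n) x₁).target :=
    (extChartAt (𝓡 n) x₁).map_source h₁
  have hc : ContinuousAt (extChartAt (𝓡 n) x₁).symm (extChartAt (𝓡 n) x₁ x) :=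
    continuousAt_extChartAt_symm'' ht
  have hs : ∀ᶠ z in 𝓝 (extChartAt (𝓡 n) x₁ x),
      (extChartAt (𝓡 n) x₁).symm z ∈ (extChartAt (𝓡 n) x₀).source := by
    refine hc.eventually ((isOpen_extChartAt_source x₀).mem_nhds ?_)
    rwa [(extChartAt (𝓡 n) x₁).left_inv h₁]
  filter_upwards [hs, (isOpen_extChartAt_target x₁).mem_nhds ht] with z hz hzt
  have h2 := fieldCoeff_change g hz ((extChartAt (𝓡 n) x₁).map_target hzt)
  rw [(extChartAt (𝓡 n) x₁).right_inv hzt] at h2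
  rw [coeff_eq_fieldCoeff g hzt, h2, Function.comp_apply, coeff_eq_fieldCoeff g ((extChartAt (𝓡 n) x₀).map_source hz),
    (extChartAt (𝓡 n) x₀).left_inv hz]

/-- The definition uses a chart that moves with `x`. Invariance replaces it by one fixed chart, as
continuity and integration require. -/
theorem scalarCurvature_eq (g : Metric k n M) (hk : 2 ≤ k) {x₀ x : M}
    (h₀ : x ∈ (extChartAt (𝓡 n) x₀).source) :
    scalarCurvature g x = coordScalar (coeff g x₀) (extChartAt (𝓡 n) x₀ x) := by
  have h₁ : x ∈ (extChartAt (𝓡 n) x).source := mem_extChartAt_source x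
  have ht := (extChartAt (𝓡 n) x).map_source h₁
  have hk' : (2 : WithTop ℕ∞) ≤ k := WithTop.coe_le_coe.2 hk
  have hψ : (extChartAt (𝓡 n) x₀ ∘ (extChartAt (𝓡 n) x).symm) (extChartAt (𝓡 n) x x)
      = extChartAt (𝓡 n) x₀ x := by
    rw [Function.comp_apply, (extChartAt (𝓡 n) x).left_inv h₁]
  rw [scalarCurvature, coordScalar_eq_of_pullback (coeff_isSymm g x₀) (coeff_isSymm g x)
    ((contDiffAt_transition h₀ h₁).of_le (WithTop.coe_le_coe.2 (le_top : (3 : ℕ∞) ≤ ⊤))) ?_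
    ((matContDiffAt_coeff g ht).of_le hk') (coeff_posDef g ht).det_pos.ne' (coeff_change g h₀ h₁),
    hψ]
  rw [hψ]
  exact (matContDiffAt_coeff g ((extChartAt (𝓡 n) x₀).map_source h₀)).of_le hk'

end Charts

/-! ### Regularity of the scalar curvature -/

section Continuity

variable {n : ℕ} {G : EuclideanSpace ℝ (Fin n) → Matrix (Fin n) (Fin n) ℝ}
  {y : EuclideanSpace ℝ (Fin n)}

theorem continuousAt_coordScalar (hG : MatContDiffAt 2 G y) (hdet : (G y).det ≠ 0) :
    ContinuousAt (coordScalar G) y := by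
  have hΓ : ∀ c a b, ContDiffAt ℝ 1 (christoffel G c a b) y := fun c a b =>
    matContDiffAt_conn hG (m := 1) (by norm_num) hdet a c b
  have hdΓ : ∀ e c a b, ContinuousAt (pderiv e (christoffel G c a b)) y := fun e c a b =>
    (contDiffAt_pderiv (hΓ c a b) (m := 0) (by norm_num) e).continuousAt
  have hric : ∀ a b, ContinuousAt (ricci G a b) y := fun a b => by
    refine (tendsto_finsetSum _ fun c _ => (hdΓ _ _ _ _).sub (hdΓ _ _ _ _)).add ?_
    exact tendsto_finsetSum _ fun c _ => tendsto_finsetSum _ fun d _ =>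
      ((hΓ _ _ _).continuousAt.mul (hΓ _ _ _).continuousAt).sub
        ((hΓ _ _ _).continuousAt.mul (hΓ _ _ _).continuousAt)
  exact tendsto_finsetSum _ fun a _ => tendsto_finsetSum _ fun b _ =>
    ((hG.inv hdet a b).continuousAt).mul (hric a b)

theorem det_fderiv_eq_jacobian {ψ : EuclideanSpace ℝ (Fin n) → EuclideanSpace ℝ (Fin n)}
    (hψ : DifferentiableAt ℝ ψ y) : (fderiv ℝ ψ y).det = (jacobian ψ y).det := by
  have h : LinearMap.toMatrix (EuclideanSpace.basisFun (Fin n) ℝ).toBasis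
      (EuclideanSpace.basisFun (Fin n) ℝ).toBasis (fderiv ℝ ψ y : _ →ₗ[ℝ] _) = jacobian ψ y := by
    ext i j
    rw [LinearMap.toMatrix_apply]
    simp [fderiv_single_eq_jacobian hψ]
  rw [← h, LinearMap.det_toMatrix]

end Continuity

/-! ### Scalar curvature as a function on the manifold -/

section Manifold

variable {k : ℕ∞} {n : ℕ} {M : Type*} [TopologicalSpace M]
  [ChartedSpace (EuclideanSpace ℝ (Fin n)) M] [IsManifold (𝓡 n) ∞ M]

theorem continuous_scalarCurvature (g : Metric k n M) (hk : 2 ≤ k) :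
    Continuous (scalarCurvature g) := by
  rw [continuous_iff_continuousAt]
  intro x₀
  have hk' : (2 : WithTop ℕ∞) ≤ k := WithTop.coe_le_coe.2 hk
  have ht := mem_extChartAt_target (I := 𝓡 n) x₀
  have h1 : ContinuousAt (fun x => coordScalar (coeff g x₀) (extChartAt (𝓡 n) x₀ x)) x₀ :=
    ContinuousAt.comp (g := coordScalar (coeff g x₀))
      (continuousAt_coordScalar ((matContDiffAt_coeff g ht).of_le hk')
        (coeff_posDef g ht).det_pos.ne') (continuousAt_extChartAt x₀)
  refine h1.congr ?_
  filter_upwards [extChartAt_source_mem_nhds (I := 𝓡 n) x₀] with x hx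
  exact (scalarCurvature_eq g hk hx).symm

theorem scalarCurvature_congr {g g' : Metric k n M} {x : M}
    (h : ∀ᶠ z in 𝓝 x, g.inner z = g'.inner z) : scalarCurvature g x = scalarCurvature g' x := by
  have hc : ContinuousAt (extChartAt (𝓡 n) x).symm (extChartAt (𝓡 n) x x) :=
    continuousAt_extChartAt_symm x
  rw [← extChartAt_to_inv (I := 𝓡 n) x] at h
  refine coordScalar_congr ?_
  filter_upwards [hc.eventually h] with y hy
  ext a b
  simp only [coeff, Matrix.of_apply, hy]

/-! ### The Riemannian volume -/

variable [MeasurableSpace M] [BorelSpace M]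

theorem aemeasurable_extChartAt_symm (x₀ : M) : AEMeasurable (extChartAt (𝓡 n) x₀).symm
    (volume.restrict (extChartAt (𝓡 n) x₀).target) :=
  (continuousOn_extChartAt_symm x₀).aemeasurable (isOpen_extChartAt_target x₀).measurableSet

theorem chartVolume_apply (g : Metric k n M) (x₀ : M) {s : Set M} (hs : MeasurableSet s) :
    chartVolume g x₀ s = ∫⁻ y in (extChartAt (𝓡 n) x₀).target ∩ (extChartAt (𝓡 n) x₀).symm ⁻¹' s,
      ENNReal.ofReal (volDensity (coeff g x₀) y) := by
  rw [chartVolume, Measure.map_apply_of_aemeasurable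
    ((aemeasurable_extChartAt_symm x₀).mono_ac (withDensity_absolutelyContinuous _ _)) hs,
    withDensity_apply', Measure.restrict_restrict' (isOpen_extChartAt_target x₀).measurableSet,
    inter_comm]
  rfl

theorem measurableSet_target_inter_preimage (x₀ : M) {s : Set M} (hs : MeasurableSet s) :
    MeasurableSet ((extChartAt (𝓡 n) x₀).target ∩ (extChartAt (𝓡 n) x₀).symm ⁻¹' s) := by
  have h := (continuousOn_iff_continuous_domRestrict.1
    (continuousOn_extChartAt_symm (I := 𝓡 n) x₀)).measurable hs
  have h2 := (isOpen_extChartAt_target (I := 𝓡 n) x₀).measurableSet.subtype_image h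
  convert h2 using 1
  ext y
  simp [and_comm]

theorem volDensity_coeff_change (g : Metric k n M) {x₀ x₁ x : M}
    (h₀ : x ∈ (extChartAt (𝓡 n) x₀).source) (h₁ : x ∈ (extChartAt (𝓡 n) x₁).source) :
    volDensity (coeff g x₁) (extChartAt (𝓡 n) x₁ x)
      = |(fderiv ℝ (extChartAt (𝓡 n) x₀ ∘ (extChartAt (𝓡 n) x₁).symm)
          (extChartAt (𝓡 n) x₁ x)).det| * volDensity (coeff g x₀)
            ((extChartAt (𝓡 n) x₀ ∘ (extChartAt (𝓡 n) x₁).symm) (extChartAt (𝓡 n) x₁ x)) := by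
  rw [det_fderiv_eq_jacobian ((contDiffAt_transition h₀ h₁).differentiableAt (by simp)),
    volDensity, volDensity, (coeff_change g h₀ h₁).self_of_nhds, Matrix.det_mul, Matrix.det_mul,
    Matrix.det_transpose, ← Real.sqrt_sq_eq_abs, ← Real.sqrt_mul (sq_nonneg _)]
  congr 1
  ring

/-- Change of variables along the transition map: its Jacobian determinant is precisely the factor
by which the two densities differ. -/
theorem chartVolume_eq_of_subset (g : Metric k n M) {x₀ x₁ : M} {s : Set M} (hs : MeasurableSet s)
    (h₀ : s ⊆ (extChartAt (𝓡 n) x₀).source) (h₁ : s ⊆ (extChartAt (𝓡 n) x₁).source) :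
    chartVolume g x₁ s = chartVolume g x₀ s := by
  set ψ := extChartAt (𝓡 n) x₀ ∘ (extChartAt (𝓡 n) x₁).symm with hψ
  set A := (extChartAt (𝓡 n) x₁).target ∩ (extChartAt (𝓡 n) x₁).symm ⁻¹' s with hA
  have hAm : MeasurableSet A := measurableSet_target_inter_preimage x₁ hs
  have himg : (extChartAt (𝓡 n) x₀).target ∩ (extChartAt (𝓡 n) x₀).symm ⁻¹' s = ψ '' A := by
    ext y
    constructor
    · rintro ⟨hy, hys⟩
      have h1 := h₁ hys
      refine ⟨extChartAt (𝓡 n) x₁ ((extChartAt (𝓡 n) x₀).symm y),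
        ⟨(extChartAt (𝓡 n) x₁).map_source h1, ?_⟩, ?_⟩
      · rw [mem_preimage, (extChartAt (𝓡 n) x₁).left_inv h1]
        exact hys
      · rw [hψ, Function.comp_apply, (extChartAt (𝓡 n) x₁).left_inv h1,
          (extChartAt (𝓡 n) x₀).right_inv hy]
    · rintro ⟨z, ⟨hz, hzs⟩, rfl⟩
      have h0 := h₀ hzs
      refine ⟨(extChartAt (𝓡 n) x₀).map_source h0, ?_⟩
      rw [hψ, mem_preimage, Function.comp_apply, (extChartAt (𝓡 n) x₀).left_inv h0]
      exact hzs
  have hinj : InjOn ψ A := by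
    rintro z ⟨hz, hzs⟩ w ⟨hw, hws⟩ h
    exact (extChartAt (𝓡 n) x₁).symm.injOn hz hw
      ((extChartAt (𝓡 n) x₀).injOn (h₀ hzs) (h₀ hws) h)
  have hder : ∀ z ∈ A, HasFDerivWithinAt ψ (fderiv ℝ ψ z) A z := by
    rintro z ⟨hz, hzs⟩
    have := contDiffAt_transition (h₀ hzs) (h₁ hzs)
    rw [(extChartAt (𝓡 n) x₁).right_inv hz] at this
    exact (this.differentiableAt (by simp)).hasFDerivAt.hasFDerivWithinAt
  rw [chartVolume_apply g x₁ hs, chartVolume_apply g x₀ hs, himg,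
    lintegral_image_eq_lintegral_abs_det_fderiv_mul volume hAm hder hinj]
  refine setLIntegral_congr_fun hAm ?_
  rintro z ⟨hz, hzs⟩
  have := volDensity_coeff_change g (h₀ hzs) (h₁ hzs)
  rw [(extChartAt (𝓡 n) x₁).right_inv hz] at this
  simp only [this]
  rw [ENNReal.ofReal_mul (abs_nonneg _)]

theorem chartVolume_compl_source (g : Metric k n M) (x₀ : M) :
    chartVolume g x₀ (extChartAt (𝓡 n) x₀).sourceᶜ = 0 := by
  rw [chartVolume_apply g x₀ (isOpen_extChartAt_source x₀).measurableSet.compl]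
  have : (extChartAt (𝓡 n) x₀).target ∩ (extChartAt (𝓡 n) x₀).symm ⁻¹'
      (extChartAt (𝓡 n) x₀).sourceᶜ = ∅ := by
    ext y
    simp only [mem_inter_iff, mem_preimage, mem_compl_iff, mem_empty_iff_false, iff_false, not_and,
      not_not]
    exact fun hy => (extChartAt (𝓡 n) x₀).map_target hy
  rw [this]
  simp

/-- Adding to `ν` the volume restricted to the complement of `T` gives an upper bound of all chart
volumes, hence of their supremum. Restriction to `T` then removes the added part. -/
theorem volumeMeasure_restrict_le (g : Metric k n M) {T : Set M} (hT : MeasurableSet T)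
    {ν : Measure M} (h : ∀ x₁, (chartVolume g x₁).restrict T ≤ ν) :
    (volumeMeasure g).restrict T ≤ ν := by
  have h1 : volumeMeasure g ≤ ν + (volumeMeasure g).restrict Tᶜ := by
    refine iSup_le fun x₁ => ?_
    rw [← Measure.restrict_add_restrict_compl (μ := chartVolume g x₁) hT]
    exact add_le_add (h x₁) (Measure.restrict_mono subset_rfl (le_iSup (chartVolume g) x₁))
  calc (volumeMeasure g).restrict T ≤ (ν + (volumeMeasure g).restrict Tᶜ).restrict T :=
        Measure.restrict_mono subset_rfl h1
    _ = ν.restrict T := by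
        rw [Measure.restrict_add, Measure.restrict_restrict hT]
        simp
    _ ≤ ν := Measure.restrict_le_self

/-- Another chart volume is concentrated on its own domain and agrees with this one on the overlap,
so over this domain none exceeds it. No countability of the atlas is needed. -/
theorem volumeMeasure_restrict_source (g : Metric k n M) (x₀ : M) :
    (volumeMeasure g).restrict (extChartAt (𝓡 n) x₀).source = chartVolume g x₀ := by
  have hS := (isOpen_extChartAt_source (I := 𝓡 n) x₀).measurableSet
  refine le_antisymm (volumeMeasure_restrict_le g hS fun x₁ => ?_) ?_
  · refine Measure.le_iff.2 fun s hs => ?_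
    have hS₁ := (isOpen_extChartAt_source (I := 𝓡 n) x₁).measurableSet
    rw [Measure.restrict_apply hs]
    calc chartVolume g x₁ (s ∩ (extChartAt (𝓡 n) x₀).source)
        = chartVolume g x₁ (s ∩ (extChartAt (𝓡 n) x₀).source ∩ (extChartAt (𝓡 n) x₁).source) := by
          refine (measure_inter_conull ?_).symm
          exact chartVolume_compl_source g x₁
      _ = chartVolume g x₀ (s ∩ (extChartAt (𝓡 n) x₀).source ∩ (extChartAt (𝓡 n) x₁).source) :=
          chartVolume_eq_of_subset g ((hs.inter hS).inter hS₁)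
            (inter_subset_left.trans inter_subset_right) inter_subset_right
      _ ≤ chartVolume g x₀ s := measure_mono (inter_subset_left.trans inter_subset_left)
  · calc chartVolume g x₀ = (chartVolume g x₀).restrict (extChartAt (𝓡 n) x₀).source := by
          refine (Measure.restrict_eq_self_of_ae_mem ?_).symm
          exact chartVolume_compl_source g x₀
      _ ≤ _ := Measure.restrict_mono subset_rfl (le_iSup (chartVolume g) x₀)

/-- The set need not lie in a single chart, so the comparison is made for each chart volume
separately; symmetry in the two metrics gives equality. -/
theorem volumeMeasure_restrict_congr {g g' : Metric k n M} {T : Set M} (hT : MeasurableSet T)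
    (h : ∀ x ∈ T, g.inner x = g'.inner x) :
    (volumeMeasure g).restrict T = (volumeMeasure g').restrict T := by
  have key : ∀ g g' : Metric k n M, (∀ x ∈ T, g.inner x = g'.inner x) →
      (volumeMeasure g).restrict T ≤ (volumeMeasure g').restrict T := by
    intro g g' h
    refine volumeMeasure_restrict_le g hT fun x₁ => ?_
    refine le_trans (Measure.le_iff.2 fun s hs => ?_)
      (Measure.restrict_mono subset_rfl (le_iSup (chartVolume g') x₁))
    rw [Measure.restrict_apply hs, Measure.restrict_apply hs, chartVolume_apply g x₁ (hs.inter hT),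
      chartVolume_apply g' x₁ (hs.inter hT)]
    refine (setLIntegral_congr_fun (measurableSet_target_inter_preimage x₁ (hs.inter hT)) ?_).le
    rintro y ⟨-, -, hy⟩
    have : coeff g x₁ y = coeff g' x₁ y := by
      ext a b
      simp only [coeff, Matrix.of_apply, h _ hy]
    simp only [volDensity, this]
  exact le_antisymm (key g g' h) (key g' g fun x hx => (h x hx).symm)

/-- Each point has a neighbourhood whose chart image lies in a closed ball inside the target, where
the continuous density is integrable. -/
theorem isLocallyFiniteMeasure_volumeMeasure (g : Metric k n M) :
    IsLocallyFiniteMeasure (volumeMeasure g) := by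
  refine ⟨fun x₀ => ?_⟩
  set Ω := (extChartAt (𝓡 n) x₀).target with hΩ
  have ht : Ω ∈ 𝓝 (extChartAt (𝓡 n) x₀ x₀) := extChartAt_target_mem_nhds x₀
  obtain ⟨r, hr, hrΩ⟩ := Metric.nhds_basis_closedBall.mem_iff.1 ht
  set K := Metric.closedBall (extChartAt (𝓡 n) x₀ x₀) r
  have hcont : ContinuousOn (volDensity (coeff g x₀)) K := fun y hy =>
    (contDiffAt_volDensity (coeff_posDef g (hrΩ hy)).det_pos
      (matContDiffAt_coeff g (hrΩ hy))).continuousAt.continuousWithinAt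
  have hint : IntegrableOn (volDensity (coeff g x₀)) K :=
    hcont.integrableOn_compact (isCompact_closedBall _ _)
  obtain ⟨N, hNs, hNo, hxN⟩ := mem_nhds_iff.1 (inter_mem (extChartAt_source_mem_nhds (I := 𝓡 n) x₀)
    ((continuousAt_extChartAt (I := 𝓡 n) x₀).preimage_mem_nhds (Metric.closedBall_mem_nhds _ hr)))
  refine ⟨N, hNo.mem_nhds hxN, ?_⟩
  have h1 : volumeMeasure g N = chartVolume g x₀ N := by
    rw [← volumeMeasure_restrict_source, Measure.restrict_apply hNo.measurableSet,
      inter_eq_left.2 (hNs.trans inter_subset_left)]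
  rw [h1, chartVolume_apply g x₀ hNo.measurableSet]
  refine lt_of_le_of_lt (lintegral_mono_set (t := K) ?_) ?_
  · rintro y ⟨hy, hyN⟩
    have := (hNs hyN).2
    rwa [mem_preimage, (extChartAt (𝓡 n) x₀).right_inv hy] at this
  · refine lt_of_le_of_lt (lintegral_mono fun y => ?_) hint.hasFiniteIntegral
    rw [Real.enorm_eq_ofReal_abs]
    exact ENNReal.ofReal_le_ofReal (le_abs_self _)

/-! ### Integrals of the scalar curvature on a compact manifold -/

variable [CompactSpace M]

theorem integrable_scalarCurvature (g : Metric k n M) (hk : 2 ≤ k) :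
    Integrable (scalarCurvature g) (volumeMeasure g) := by
  have := isLocallyFiniteMeasure_volumeMeasure g
  exact (continuous_scalarCurvature g hk).integrable_of_hasCompactSupport
    (HasCompactSupport.of_compactSpace _)

theorem setIntegral_source (g : Metric k n M) (hk : 2 ≤ k) (x₀ : M) :
    IntegrableOn (fun y => volDensity (coeff g x₀) y * coordScalar (coeff g x₀) y)
      (extChartAt (𝓡 n) x₀).target ∧
    ∫ x in (extChartAt (𝓡 n) x₀).source, scalarCurvature g x ∂(volumeMeasure g)
      = ∫ y in (extChartAt (𝓡 n) x₀).target,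
          volDensity (coeff g x₀) y * coordScalar (coeff g x₀) y := by
  have hΩ := (isOpen_extChartAt_target (I := 𝓡 n) x₀).measurableSet
  have hcont : ContinuousOn (volDensity (coeff g x₀)) (extChartAt (𝓡 n) x₀).target := fun y hy =>
    (contDiffAt_volDensity (coeff_posDef g hy).det_pos
      (matContDiffAt_coeff g hy)).continuousAt.continuousWithinAt
  have hsm := (continuous_scalarCurvature g hk).stronglyMeasurable
  have hsymm := (aemeasurable_extChartAt_symm (n := n) x₀).mono_ac (withDensity_absolutelyContinuous _
    fun y => ENNReal.ofReal (Real.sqrt (coeff g x₀ y).det))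
  have hdens : AEMeasurable (fun y => ENNReal.ofReal (Real.sqrt (coeff g x₀ y).det))
      (volume.restrict (extChartAt (𝓡 n) x₀).target) := (hcont.aemeasurable hΩ).ennreal_ofReal
  have hpt : ∀ y ∈ (extChartAt (𝓡 n) x₀).target,
      (ENNReal.ofReal (Real.sqrt (coeff g x₀ y).det)).toReal
        • scalarCurvature g ((extChartAt (𝓡 n) x₀).symm y)
      = volDensity (coeff g x₀) y * coordScalar (coeff g x₀) y := by
    intro y hy
    rw [smul_eq_mul, ENNReal.toReal_ofReal (Real.sqrt_nonneg _),
      scalarCurvature_eq g hk ((extChartAt (𝓡 n) x₀).map_target hy),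
      (extChartAt (𝓡 n) x₀).right_inv hy]
    rfl
  constructor
  · have h := (integrable_scalarCurvature g hk).restrict (s := (extChartAt (𝓡 n) x₀).source)
    rw [volumeMeasure_restrict_source, chartVolume,
      integrable_map_measure hsm.aestronglyMeasurable hsymm,
      integrable_withDensity_iff_integrable_smul₀' hdens
        (ae_of_all _ fun _ => ENNReal.ofReal_lt_top)] at h
    exact IntegrableOn.congr_fun h hpt hΩ
  · rw [volumeMeasure_restrict_source, chartVolume,
      integral_map hsymm hsm.aestronglyMeasurable,
      integral_withDensity_eq_integral_toReal_smul₀ hdens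
        (ae_of_all _ fun _ => ENNReal.ofReal_lt_top)]
    exact setIntegral_congr_fun hΩ hpt

/-- Total scalar curvatures of metrics which agree outside of a closed subset of a chart domain
are compared in this chart. -/
theorem totalScalarCurvature_sub (hk : 2 ≤ k) {g g' : Metric k n M} {x₀ : M} {K : Set M}
    (hK : IsClosed K) (hKs : K ⊆ (extChartAt (𝓡 n) x₀).source)
    (h : ∀ x ∉ K, g.inner x = g'.inner x) :
    totalScalarCurvature g - totalScalarCurvature g'
      = ∫ y in (extChartAt (𝓡 n) x₀).target,
          (volDensity (coeff g x₀) y * coordScalar (coeff g x₀) y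
            - volDensity (coeff g' x₀) y * coordScalar (coeff g' x₀) y) := by
  have hS := (isOpen_extChartAt_source (I := 𝓡 n) x₀).measurableSet
  -- Curvature depends on the metric near a point. Closedness of `K` upgrades agreement off `K` to
  -- agreement on a neighbourhood of each point outside the chart domain.
  have hout : ∫ x in (extChartAt (𝓡 n) x₀).sourceᶜ, scalarCurvature g x ∂(volumeMeasure g)
      = ∫ x in (extChartAt (𝓡 n) x₀).sourceᶜ, scalarCurvature g' x ∂(volumeMeasure g') := by
    rw [volumeMeasure_restrict_congr hS.compl fun x hx => h x fun hxK => hx (hKs hxK)]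
    refine setIntegral_congr_fun hS.compl fun x hx => scalarCurvature_congr ?_
    filter_upwards [hK.isOpen_compl.mem_nhds fun hxK => hx (hKs hxK)] with z hz
    exact h z hz
  have hg := setIntegral_source g hk x₀
  have hg' := setIntegral_source g' hk x₀
  rw [totalScalarCurvature, totalScalarCurvature,
    ← integral_add_compl hS (integrable_scalarCurvature g hk),
    ← integral_add_compl hS (integrable_scalarCurvature g' hk), hout, hg.2, hg'.2,
    integral_sub hg.1 hg'.1]
  ring

end Manifold

/-! ### Oscillating conformal factors in coordinates -/

section Integrals

variable {n : ℕ}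

/-- Integration by parts against the constant function `1`. -/
theorem integral_pderiv_eq_zero {f : EuclideanSpace ℝ (Fin n) → ℝ} (hf : ContDiff ℝ 1 f)
    (hc : HasCompactSupport f) (c : Fin n) : ∫ y, pderiv c f y = 0 := by
  have h1 : Integrable (fun y => fderiv ℝ f y (EuclideanSpace.single c 1)) :=
    ((hf.continuous_fderiv one_ne_zero).clm_apply continuous_const).integrable_of_hasCompactSupport
      (hc.fderiv_apply ℝ _)
  have h2 : Integrable f := hf.continuous.integrable_of_hasCompactSupport hc
  have := integral_mul_fderiv_eq_neg_fderiv_mul_of_integrable (𝕜 := ℝ) (μ := volume)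
    (f := fun _ : EuclideanSpace ℝ (Fin n) => (1 : ℝ)) (g := f)
    (v := EuclideanSpace.single c (1 : ℝ)) (by simp) (by simpa using h1) (by simpa using h2)
    (fun x _ => differentiableAt_const _) (fun x _ => (hf.differentiable one_ne_zero) x)
  simpa [pderiv] using this

/-- Riemann-Lebesgue for the indicator function of `s`. The shift by `r` contributes only a phase of
modulus one. -/
theorem tendsto_setIntegral_cos {s : Set (EuclideanSpace ℝ (Fin n))} (hs : MeasurableSet s)
    (hsf : volume s ≠ ⊤) (a : Fin n) (r : ℝ) :
    Tendsto (fun N : ℝ => ∫ y in s, Real.cos (2 * (N * (y a - r)))) atTop (𝓝 0) := by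
  have h1 := tendsto_integral_exp_inner_smul_cocompact
    (s.indicator fun _ : EuclideanSpace ℝ (Fin n) => (1 : ℂ))
  -- The Fourier character contains a factor `2π`, so the frequency `N / π` produces `exp (-2 i N
  -- v_a)`.
  have hw : Tendsto (fun N : ℝ => EuclideanSpace.single a (N / Real.pi)) atTop
      (cocompact (EuclideanSpace ℝ (Fin n))) := by
    refine tendsto_cocompact_of_tendsto_dist_comp_atTop 0 ?_
    have : Tendsto (fun N : ℝ => |N / Real.pi|) atTop atTop :=
      tendsto_abs_atTop_atTop.comp (tendsto_id.atTop_div_const Real.pi_pos)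
    refine this.congr fun N => ?_
    rw [dist_zero_right, PiLp.norm_single, Real.norm_eq_abs]
  have h2 := (h1.comp hw).norm
  rw [norm_zero] at h2
  refine squeeze_zero_norm (fun N => ?_) h2
  set I := ∫ v : EuclideanSpace ℝ (Fin n), Real.fourierChar
    (-inner ℝ v (EuclideanSpace.single a (N / Real.pi)))
      • s.indicator (fun _ : EuclideanSpace ℝ (Fin n) => (1 : ℂ)) v with hI
  have hI2 : I = ∫ v in s, Complex.exp (((-(2 * (N * v a)) : ℝ) : ℂ) * Complex.I) := by
    rw [hI, ← integral_indicator hs]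
    refine integral_congr_ae (ae_of_all _ fun v => ?_)
    by_cases hv : v ∈ s
    · simp only [indicator_of_mem hv, Circle.smul_def, Real.fourierChar_apply, smul_eq_mul, mul_one]
      congr 3
      have hpi := Real.pi_ne_zero
      rw [EuclideanSpace.inner_single_right]
      simp only [conj_trivial]
      field_simp
    · simp only [indicator_of_notMem hv, smul_zero]
  have hint : IntegrableOn
      (fun v : EuclideanSpace ℝ (Fin n) =>
        Complex.exp ((2 * (N * r) : ℝ) * Complex.I)
          * Complex.exp (((-(2 * (N * v a)) : ℝ) : ℂ) * Complex.I)) s := by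
    have : IsFiniteMeasure (volume.restrict s) := ⟨by simpa using hsf.lt_top⟩
    refine Integrable.of_bound (C := 1) ?_ (ae_of_all _ fun v => ?_)
    · refine Continuous.aestronglyMeasurable ?_
      fun_prop
    · rw [norm_mul, Complex.norm_exp_ofReal_mul_I, Complex.norm_exp_ofReal_mul_I, one_mul]
  have hre : ∫ y in s, Real.cos (2 * (N * (y a - r)))
      = (Complex.exp ((2 * (N * r) : ℝ) * Complex.I) * I).re := by
    rw [hI2, ← integral_const_mul]
    have := integral_re hint
    simp only [RCLike.re_eq_complex_re] at this
    rw [← this]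
    refine integral_congr_ae (ae_of_all _ fun v => ?_)
    simp only
    rw [← Complex.exp_add, ← add_mul, ← Complex.ofReal_add, Complex.exp_ofReal_mul_I_re,
      ← Real.cos_neg]
    congr 1
    ring
  rw [hre, Real.norm_eq_abs]
  refine (Complex.abs_re_le_norm _).trans ?_
  rw [norm_mul, Complex.norm_exp_ofReal_mul_I, one_mul]
  rfl

end Integrals

/-! ### The oscillating factor: pointwise curvature and integral estimates -/

section Oscillation

variable {n : ℕ} {y₀ : EuclideanSpace ℝ (Fin n)}

/-- The oscillating function `N⁻¹ B sin (N (y^a - y₀^a))`. -/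
def osc (B : ContDiffBump y₀) (a : Fin n) (N : ℝ) (y : EuclideanSpace ℝ (Fin n)) : ℝ :=
  B y * (N⁻¹ * Real.sin (N * (y a - y₀ a)))

variable (B : ContDiffBump y₀) (a : Fin n) {N : ℝ} {y : EuclideanSpace ℝ (Fin n)}

theorem contDiff_osc : ContDiff ℝ ∞ (osc B a N) := by
  have h : ContDiff ℝ ∞ fun y : EuclideanSpace ℝ (Fin n) => y a :=
    contDiff_piLp_apply 2
  exact B.contDiff.mul (contDiff_const.mul (contDiff_const.mul (h.sub contDiff_const)).sin)

theorem contDiff_two_osc : ContDiff ℝ 2 (osc B a N) :=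
  (contDiff_osc B a).of_le (WithTop.coe_le_coe.2 (le_top : (2 : ℕ∞) ≤ ⊤))

theorem abs_osc_le (hN : 0 < N) : |osc B a N y| ≤ N⁻¹ := by
  rw [osc, abs_mul, abs_mul, abs_of_nonneg B.nonneg, abs_of_pos (inv_pos.2 hN)]
  calc B y * (N⁻¹ * |Real.sin (N * (y a - y₀ a))|) ≤ 1 * (N⁻¹ * 1) := by
        gcongr
        exacts [B.le_one, Real.abs_sin_le_one _]
    _ = N⁻¹ := by ring

theorem osc_eventuallyEq_zero (hy : y ∉ Metric.closedBall y₀ B.rOut) : osc B a N =ᶠ[𝓝 y] 0 := by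
  filter_upwards [Metric.isClosed_closedBall.isOpen_compl.mem_nhds hy] with z hz
  rw [osc, B.zero_of_le_dist, zero_mul, Pi.zero_apply]
  exact (not_le.1 (mt Metric.mem_closedBall.2 hz)).le

theorem osc_eventuallyEq (hy : y ∈ Metric.ball y₀ B.rIn) :
    osc B a N =ᶠ[𝓝 y] fun z => N⁻¹ * Real.sin (N * (z a - y₀ a)) := by
  filter_upwards [B.eventuallyEq_one_of_mem_ball hy] with z hz
  rw [osc, hz, Pi.one_apply, one_mul]

theorem pderiv_coord (c : Fin n) (r : ℝ) :
    pderiv c (fun z : EuclideanSpace ℝ (Fin n) => N * (z a - r)) y = if c = a then N else 0 := by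
  have h : DifferentiableAt ℝ (fun z : EuclideanSpace ℝ (Fin n) => z a) y := by fun_prop
  rw [pderiv_const_mul (h.sub_const r), pderiv_sub h (differentiableAt_const r), pderiv_const,
    sub_zero]
  have h2 : fderiv ℝ (fun z : EuclideanSpace ℝ (Fin n) => z a) y
      = (EuclideanSpace.proj (𝕜 := ℝ) a : EuclideanSpace ℝ (Fin n) →L[ℝ] ℝ) :=
    (EuclideanSpace.proj (𝕜 := ℝ) a : EuclideanSpace ℝ (Fin n) →L[ℝ] ℝ).fderiv
  rw [pderiv, h2]
  simp [eq_comm]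

theorem pderiv_osc (hN : N ≠ 0) (hy : y ∈ Metric.ball y₀ B.rIn) (c : Fin n) :
    pderiv c (osc B a N) y = if c = a then Real.cos (N * (y a - y₀ a)) else 0 := by
  have hd : DifferentiableAt ℝ (fun z : EuclideanSpace ℝ (Fin n) => N * (z a - y₀ a)) y := by
    fun_prop
  rw [pderiv_congr (osc_eventuallyEq B a hy), pderiv_const_mul hd.sin,
    pderiv_scomp (f := fun z => N * (z a - y₀ a)) (Real.hasDerivAt_sin _) hd, pderiv_coord]
  split_ifs
  · field_simp
  · ring

theorem pderiv_pderiv_osc (hN : N ≠ 0) (hy : y ∈ Metric.ball y₀ B.rIn) (c d : Fin n) :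
    pderiv c (pderiv d (osc B a N)) y
      = if c = a ∧ d = a then -(N * Real.sin (N * (y a - y₀ a))) else 0 := by
  have hd : DifferentiableAt ℝ (fun z : EuclideanSpace ℝ (Fin n) => N * (z a - y₀ a)) y := by
    fun_prop
  have h : pderiv d (osc B a N) =ᶠ[𝓝 y]
      fun z => if d = a then Real.cos (N * (z a - y₀ a)) else 0 := by
    filter_upwards [Metric.isOpen_ball.mem_nhds hy] with z hz
    exact pderiv_osc B a hN hz d
  rw [pderiv_congr h]
  by_cases hda : d = a
  · simp only [hda, if_true, and_true]
    rw [pderiv_scomp (f := fun z => N * (z a - y₀ a)) (Real.hasDerivAt_cos _) hd, pderiv_coord]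
    split_ifs <;> ring
  · simp [hda]

/-- Coefficients of a `C²` Riemannian metric at the points of `Ω`. -/
structure IsMetricOn (G : EuclideanSpace ℝ (Fin n) → Matrix (Fin n) (Fin n) ℝ)
    (Ω : Set (EuclideanSpace ℝ (Fin n))) : Prop where
  symm : ∀ z, (G z).IsSymm
  posDef : ∀ z ∈ Ω, (G z).PosDef
  contDiff : ∀ z ∈ Ω, MatContDiffAt 2 G z

variable {G : EuclideanSpace ℝ (Fin n) → Matrix (Fin n) (Fin n) ℝ}
  {Ω : Set (EuclideanSpace ℝ (Fin n))} {φ : EuclideanSpace ℝ (Fin n) → ℝ}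

namespace IsMetricOn

theorem det_pos (h : IsMetricOn G Ω) (hy : y ∈ Ω) : 0 < (G y).det := (h.posDef y hy).det_pos

theorem continuousOn_volDensity (h : IsMetricOn G Ω) : ContinuousOn (volDensity G) Ω :=
  fun y hy => (contDiffAt_volDensity (h.det_pos hy)
    (h.contDiff y hy)).continuousAt.continuousWithinAt

theorem continuousOn_coordScalar (h : IsMetricOn G Ω) : ContinuousOn (coordScalar G) Ω :=
  fun y hy => (continuousAt_coordScalar (h.contDiff y hy) (h.det_pos hy).ne').continuousWithinAt

theorem continuousOn_inv (h : IsMetricOn G Ω) (a b : Fin n) :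
    ContinuousOn (fun y => (G y)⁻¹ a b) Ω :=
  fun y hy => ((h.contDiff y hy).inv (h.det_pos hy).ne' a b).continuousAt.continuousWithinAt

theorem continuousOn_gradSq (h : IsMetricOn G Ω) (hφ : ContDiff ℝ 2 φ) :
    ContinuousOn (gradSq G φ) Ω := fun y hy => by
  refine ContinuousAt.continuousWithinAt (tendsto_finsetSum _ fun c _ => ?_)
  exact (contDiffAt_pderiv hφ.contDiffAt (m := 1) (by norm_num) c).continuousAt.mul
    (contDiffAt_grad (h.det_pos hy).ne' ((h.contDiff y hy).of_le one_le_two)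
      hφ.contDiffAt c).continuousAt

theorem gradSq_nonneg (h : IsMetricOn G Ω) (hy : y ∈ Ω) : 0 ≤ gradSq G φ y := by
  have := (h.posDef y hy).inv.posSemidef.dotProduct_mulVec_nonneg fun d => pderiv d φ y
  simpa [dotProduct, Matrix.mulVec, gradSq, grad] using this

theorem exists_bounds (h : IsMetricOn G Ω) {K : Set (EuclideanSpace ℝ (Fin n))} (hK : IsCompact K)
    (hKn : K.Nonempty) (hKΩ : K ⊆ Ω) (a : Fin n) :
    ∃ m C : ℝ, 0 < m ∧ ∀ y ∈ K, m ≤ (G y)⁻¹ a a ∧ m ≤ volDensity G y * (G y)⁻¹ a a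
      ∧ |coordScalar G y| ≤ C := by
  have c1 := (h.continuousOn_inv a a).mono hKΩ
  have c2 := ((h.continuousOn_volDensity).mono hKΩ).mul c1
  obtain ⟨y1, hy1, h1⟩ := hK.exists_isMinOn hKn c1
  obtain ⟨y2, hy2, h2⟩ := hK.exists_isMinOn hKn c2
  obtain ⟨C, hC⟩ := hK.exists_bound_of_continuousOn (h.continuousOn_coordScalar.mono hKΩ)
  have p1 : ∀ y ∈ K, 0 < (G y)⁻¹ a a := fun y hy => (h.posDef y (hKΩ hy)).inv.diag_pos
  have p2 : ∀ y ∈ K, 0 < volDensity G y := fun y hy => Real.sqrt_pos.2 (h.det_pos (hKΩ hy))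
  refine ⟨min ((G y1)⁻¹ a a) (volDensity G y2 * (G y2)⁻¹ a a), C,
    lt_min (p1 _ hy1) (mul_pos (p2 _ hy2) (p1 _ hy2)), fun y hy => ⟨?_, ?_, hC y hy⟩⟩
  · exact (min_le_left _ _).trans (h1 hy)
  · exact (min_le_right _ _).trans (h2 hy)

theorem gradSq_osc (hN : N ≠ 0) (hy : y ∈ Metric.ball y₀ B.rIn) :
    gradSq G (osc B a N) y = (G y)⁻¹ a a * Real.cos (N * (y a - y₀ a)) ^ 2 := by
  simp only [gradSq, grad, pderiv_osc B a hN hy, mul_ite, ite_mul, mul_zero, zero_mul,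
    Finset.sum_ite_eq', Finset.mem_univ, if_true]
  ring

/-- Where the cosine vanishes so do all first derivatives of the oscillation, and with them the
Christoffel terms; only the second derivative in direction `a` remains. -/
theorem laplacian_osc (h : IsMetricOn G Ω) (hyΩ : y ∈ Ω) (hN : N ≠ 0)
    (hy : y ∈ Metric.ball y₀ B.rIn) (hcos : Real.cos (N * (y a - y₀ a)) = 0) :
    laplacian G (osc B a N) y = -(N * Real.sin (N * (y a - y₀ a))) * (G y)⁻¹ a a := by
  rw [laplacian_eq h.symm (h.det_pos hyΩ).ne' ((h.contDiff y hyΩ).of_le one_le_two)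
    (contDiff_two_osc B a).contDiffAt]
  simp only [pderiv_pderiv_osc B a hN hy, pderiv_osc B a hN hy, hcos, ite_self, mul_zero,
    Finset.sum_const_zero, sub_zero, mul_ite, ite_and]
  simp [Finset.sum_ite_eq', mul_comm]

/-- The scalar curvature at the critical points of the oscillation. -/
theorem coordScalar_osc (h : IsMetricOn G Ω) (hyΩ : y ∈ Ω) (hN : N ≠ 0)
    (hy : y ∈ Metric.ball y₀ B.rIn) (hcos : Real.cos (N * (y a - y₀ a)) = 0) :
    coordScalar (fun z => Real.exp (2 * osc B a N z) • G z) y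
      = Real.exp (-(2 * osc B a N y)) * (coordScalar G y
        + 2 * (n - 1) * (N * Real.sin (N * (y a - y₀ a)) * (G y)⁻¹ a a)) := by
  rw [coordScalar_conformal h.symm (h.det_pos hyΩ).ne' (h.contDiff y hyΩ)
    (contDiff_two_osc B a).contDiffAt,
    h.laplacian_osc B a hyΩ hN hy hcos, gradSq_osc B a hN hy, hcos]
  ring

/-- The scalar curvature of the oscillating metrics takes both signs. -/
theorem exists_coordScalar_pos_neg (h : IsMetricOn G Ω) (hn : 2 ≤ n)
    (hB : Metric.closedBall y₀ B.rOut ⊆ Ω) :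
    ∀ᶠ N in atTop, (∃ y ∈ Ω, 0 < coordScalar (fun z => Real.exp (2 * osc B a N z) • G z) y)
      ∧ ∃ y ∈ Ω, coordScalar (fun z => Real.exp (2 * osc B a N z) • G z) y < 0 := by
  obtain ⟨m, C, hm, hmC⟩ := h.exists_bounds (isCompact_closedBall y₀ B.rOut)
    (Metric.nonempty_closedBall.2 B.rOut_pos.le) hB a
  have hn' : (2 : ℝ) ≤ n := by exact_mod_cast hn
  -- The second bound on `N` puts the points `y₀ ± (π / 2N) e_a`, where the sine is `±1`, into the
  -- ball on which the bump is `1`. The third makes the term of order `N` exceed the background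
  -- curvature.
  filter_upwards [eventually_gt_atTop 0, eventually_gt_atTop (Real.pi / 2 / B.rIn),
    eventually_gt_atTop (C / m)] with N hN hN1 hN2
  have hball : ∀ s : ℝ, |s| ≤ Real.pi / 2 →
      y₀ + EuclideanSpace.single a (s / N) ∈ Metric.ball y₀ B.rIn := by
    intro s hs
    rw [mem_ball_iff_norm, add_sub_cancel_left, PiLp.norm_single, Real.norm_eq_abs,
      abs_div, abs_of_pos hN, div_lt_iff₀ hN]
    rw [div_lt_iff₀ B.rIn_pos] at hN1
    linarith [mul_comm N B.rIn]
  have harg : ∀ s : ℝ, N * ((y₀ + EuclideanSpace.single a (s / N)) a - y₀ a) = s := by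
    intro s
    simp
    field_simp
  have hCm : ∀ y ∈ Metric.closedBall y₀ B.rOut, |coordScalar G y|
      < 2 * (n - 1) * (N * 1 * (G y)⁻¹ a a) := by
    intro y hy
    obtain ⟨h1, -, h3⟩ := hmC y hy
    have h4 : C < N * m := by rwa [div_lt_iff₀ hm] at hN2
    have h5 : N * m ≤ N * (G y)⁻¹ a a := mul_le_mul_of_nonneg_left h1 hN.le
    have h6 : 0 ≤ N * (G y)⁻¹ a a := mul_nonneg hN.le (hm.le.trans h1)
    nlinarith
  have hsub : Metric.ball y₀ B.rIn ⊆ Metric.closedBall y₀ B.rOut :=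
    Metric.ball_subset_closedBall.trans (Metric.closedBall_subset_closedBall B.rIn_lt_rOut.le)
  refine ⟨⟨y₀ + EuclideanSpace.single a (Real.pi / 2 / N), ?_, ?_⟩,
    ⟨y₀ + EuclideanSpace.single a (-(Real.pi / 2) / N), ?_, ?_⟩⟩
  · exact hB (hsub (hball _ (abs_of_pos Real.pi_div_two_pos).le))
  · have hb := hball _ (abs_of_pos Real.pi_div_two_pos).le
    rw [h.coordScalar_osc B a (hB (hsub hb)) hN.ne' hb (by rw [harg, Real.cos_pi_div_two]), harg,
      Real.sin_pi_div_two]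
    refine mul_pos (Real.exp_pos _) ?_
    have := hCm _ (hsub hb)
    linarith [neg_abs_le (coordScalar G (y₀ + EuclideanSpace.single a (Real.pi / 2 / N)))]
  · exact hB (hsub (hball _ (by rw [abs_neg, abs_of_pos Real.pi_div_two_pos])))
  · have hb := hball (-(Real.pi / 2)) (by rw [abs_neg, abs_of_pos Real.pi_div_two_pos])
    rw [h.coordScalar_osc B a (hB (hsub hb)) hN.ne' hb
      (by rw [harg, Real.cos_neg, Real.cos_pi_div_two]), harg, Real.sin_neg, Real.sin_pi_div_two]
    refine mul_neg_of_pos_of_neg (Real.exp_pos _) ?_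
    have := hCm _ (hsub hb)
    linarith [le_abs_self (coordScalar G (y₀ + EuclideanSpace.single a (-(Real.pi / 2) / N)))]

/-- The flux of the oscillation has no total divergence. -/
theorem setIntegral_pderiv_confFlux (h : IsMetricOn G Ω) (hB : Metric.closedBall y₀ B.rOut ⊆ Ω)
    (c : Fin n) :
    IntegrableOn (pderiv c (confFlux G (osc B a N) c)) (Metric.closedBall y₀ B.rOut) ∧
    ∫ y in Metric.closedBall y₀ B.rOut, pderiv c (confFlux G (osc B a N) c) y = 0 := by
  have hz : ∀ y ∉ Metric.closedBall y₀ B.rOut, confFlux G (osc B a N) c =ᶠ[𝓝 y] fun _ => 0 := by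
    intro y hy
    filter_upwards [(osc_eventuallyEq_zero B a (N := N) hy).eventuallyEq_nhds] with z hz
    have : ∀ d, pderiv d (osc B a N) z = 0 := fun d => by
      rw [pderiv_congr hz]
      exact pderiv_const d 0
    simp only [confFlux, grad, this, mul_zero, Finset.sum_const_zero]
  -- `G` is controlled only on `Ω`, but the flux vanishes near every point outside the ball, hence
  -- it is `C¹` on the whole space.
  have hsmooth : ContDiff ℝ 1 (confFlux G (osc B a N) c) := by
    rw [contDiff_iff_contDiffAt]
    intro y
    by_cases hy : y ∈ Metric.closedBall y₀ B.rOut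
    · exact contDiffAt_confFlux (h.det_pos (hB hy)) ((h.contDiff y (hB hy)).of_le one_le_two)
        (contDiff_two_osc B a).contDiffAt c
    · exact contDiffAt_const.congr_of_eventuallyEq (hz y hy)
  have hsupp : HasCompactSupport (confFlux G (osc B a N) c) :=
    HasCompactSupport.intro (isCompact_closedBall y₀ B.rOut) fun y hy => (hz y hy).self_of_nhds
  constructor
  · exact ((hsmooth.continuous_fderiv one_ne_zero).clm_apply
      continuous_const).continuousOn.integrableOn_compact (isCompact_closedBall _ _)
  · rw [setIntegral_eq_integral_of_forall_compl_eq_zero fun y hy => ?_]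
    · exact integral_pderiv_eq_zero hsmooth hsupp c
    · rw [pderiv_congr (hz y hy), pderiv_const]

/-- Integration of the divergence identity over the ball: the flux has zero total divergence, so
only terms of first order in the oscillation survive. -/
theorem setIntegral_osc (h : IsMetricOn G Ω) (hB : Metric.closedBall y₀ B.rOut ⊆ Ω) :
    ∫ y in Metric.closedBall y₀ B.rOut,
      (volDensity (fun z => Real.exp (2 * osc B a N z) • G z) y
        * coordScalar (fun z => Real.exp (2 * osc B a N z) • G z) y
        - volDensity G y * coordScalar G y)
      = (∫ y in Metric.closedBall y₀ B.rOut,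
          (Real.exp ((n - 2) * osc B a N y) - 1) * (volDensity G y * coordScalar G y))
        + (n - 1) * (n - 2) * ∫ y in Metric.closedBall y₀ B.rOut,
          Real.exp ((n - 2) * osc B a N y) * (volDensity G y * gradSq G (osc B a N) y) := by
  set K := Metric.closedBall y₀ B.rOut
  have hK : IsCompact K := isCompact_closedBall _ _
  have hosc2 : ContDiff ℝ 2 (osc B a N) := contDiff_two_osc B a
  have hexp : Continuous fun y => Real.exp ((n - 2) * osc B a N y) :=
    Real.continuous_exp.comp (continuous_const.mul (contDiff_osc B a).continuous)
  have cv := h.continuousOn_volDensity.mono hB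
  have i1 : IntegrableOn (fun y => (Real.exp ((n - 2) * osc B a N y) - 1)
      * (volDensity G y * coordScalar G y)) K :=
    ((hexp.sub continuous_const).continuousOn.mul
      (cv.mul (h.continuousOn_coordScalar.mono hB))).integrableOn_compact hK
  have i2 : IntegrableOn (fun y => Real.exp ((n - 2) * osc B a N y)
      * (volDensity G y * gradSq G (osc B a N) y)) K :=
    (hexp.continuousOn.mul (cv.mul ((h.continuousOn_gradSq hosc2).mono hB))).integrableOn_compact hK
  have i3 := fun c => h.setIntegral_pderiv_confFlux B a (N := N) hB c
  have i4 : IntegrableOn (fun y => ∑ c, pderiv c (confFlux G (osc B a N) c) y) K :=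
    integrable_finsetSum _ fun c _ => (i3 c).1
  have hpt : ∀ y ∈ K, volDensity (fun z => Real.exp (2 * osc B a N z) • G z) y
        * coordScalar (fun z => Real.exp (2 * osc B a N z) • G z) y
        - volDensity G y * coordScalar G y
      = (Real.exp ((n - 2) * osc B a N y) - 1) * (volDensity G y * coordScalar G y)
        + (n - 1) * (n - 2) * (Real.exp ((n - 2) * osc B a N y)
          * (volDensity G y * gradSq G (osc B a N) y))
        - 2 * (n - 1) * ∑ c, pderiv c (confFlux G (osc B a N) c) y := by
    intro y hy
    rw [volDensity_mul_coordScalar_conformal h.symm (h.det_pos (hB hy)) (h.contDiff y (hB hy))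
      hosc2.contDiffAt]
    ring
  have i5 : IntegrableOn (fun y => (Real.exp ((n - 2) * osc B a N y) - 1)
      * (volDensity G y * coordScalar G y) + (n - 1) * (n - 2) * (Real.exp ((n - 2) * osc B a N y)
        * (volDensity G y * gradSq G (osc B a N) y))) K := i1.add (i2.const_mul _)
  rw [setIntegral_congr_fun Metric.isClosed_closedBall.measurableSet hpt, integral_sub i5 (i4.const_mul _), integral_add i1 (i2.const_mul _),
    integral_const_mul, integral_const_mul, integral_finsetSum _ fun c _ => (i3 c).1]
  simp [(i3 _).2]

/-- The exponent is at most `|r| / N`, and `|e^t - 1| ≤ 2 |t|` for `|t| ≤ 1`, so the integral is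
`O(1/N)`. -/
theorem tendsto_setIntegral_exp_sub_one (h : IsMetricOn G Ω)
    (hB : Metric.closedBall y₀ B.rOut ⊆ Ω) (r : ℝ) :
    Tendsto (fun N : ℝ => ∫ y in Metric.closedBall y₀ B.rOut,
      (Real.exp (r * osc B a N y) - 1) * (volDensity G y * coordScalar G y)) atTop (𝓝 0) := by
  set K := Metric.closedBall y₀ B.rOut
  have hK : IsCompact K := isCompact_closedBall _ _
  have hi : IntegrableOn (fun y => volDensity G y * coordScalar G y) K :=
    ((h.continuousOn_volDensity.mul h.continuousOn_coordScalar).mono hB).integrableOn_compact hK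
  have hlim : Tendsto (fun N : ℝ => 2 * (|r| * N⁻¹) * ∫ y in K, ‖volDensity G y * coordScalar G y‖)
      atTop (𝓝 0) := by
    have := ((tendsto_inv_atTop_zero (𝕜 := ℝ)).const_mul |r|).const_mul 2
    simpa using this.mul_const (∫ y in K, ‖volDensity G y * coordScalar G y‖)
  refine squeeze_zero_norm' ?_ hlim
  filter_upwards [eventually_gt_atTop 0, eventually_ge_atTop |r|] with N hN hNr
  rw [← integral_const_mul]
  refine norm_integral_le_of_norm_le (hi.norm.const_mul _) (ae_of_all _ fun y => ?_)
  rw [norm_mul]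
  refine mul_le_mul_of_nonneg_right ?_ (norm_nonneg _)
  have h1 : |r * osc B a N y| ≤ |r| * N⁻¹ := by
    rw [abs_mul]
    exact mul_le_mul_of_nonneg_left (abs_osc_le B a hN) (abs_nonneg _)
  have h2 : |r| * N⁻¹ ≤ 1 := by
    rw [← div_eq_mul_inv, div_le_one hN]
    exact hNr
  rw [Real.norm_eq_abs]
  exact (Real.abs_exp_sub_one_le (h1.trans h2)).trans (by linarith)

/-- The integrand is nonnegative, so the region where the bump is cut off can be discarded. On the
inner ball the squared gradient is a positive coefficient times `cos² = 1/2 + cos(2·)/2`, whose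
oscillating half integrates to something small. -/
theorem exists_le_setIntegral_gradSq (h : IsMetricOn G Ω)
    (hB : Metric.closedBall y₀ B.rOut ⊆ Ω) (r : ℝ) :
    ∃ δ : ℝ, 0 < δ ∧ ∀ᶠ N : ℝ in atTop, δ ≤ ∫ y in Metric.closedBall y₀ B.rOut,
      Real.exp (r * osc B a N y) * (volDensity G y * gradSq G (osc B a N) y) := by
  set K := Metric.closedBall y₀ B.rOut
  have hK : IsCompact K := isCompact_closedBall _ _
  obtain ⟨m, C, hm, hmC⟩ := h.exists_bounds hK (Metric.nonempty_closedBall.2 B.rOut_pos.le) hB a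
  set b := Metric.ball y₀ B.rIn
  have hbK : b ⊆ K :=
    Metric.ball_subset_closedBall.trans (Metric.closedBall_subset_closedBall B.rIn_lt_rOut.le)
  have hbm : MeasurableSet b := Metric.isOpen_ball.measurableSet
  have hbf : volume b ≠ ⊤ := measure_ball_lt_top.ne
  have hV : 0 < volume.real b := ENNReal.toReal_pos (Metric.measure_ball_pos _ _ B.rIn_pos).ne' hbf
  have hcos := tendsto_setIntegral_cos hbm hbf a (y₀ a)
  set q := Real.exp (-|r|) * m with hq
  have hqpos : 0 < q := mul_pos (Real.exp_pos _) hm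
  -- `q` bounds the weight from below once `N ≥ 1`. The mean part of `cos²` contributes half the
  -- volume, and the oscillating part costs at most a quarter once its cosine integral exceeds
  -- `-volume / 2`.
  refine ⟨q * (volume.real b / 4), by positivity, ?_⟩
  filter_upwards [eventually_ge_atTop 1, hcos.eventually_const_lt (show -(volume.real b / 2) < 0 by
    linarith)] with N hN1 hNc
  have hN : 0 < N := by linarith
  have hosc2 : ContDiff ℝ 2 (osc B a N) := contDiff_two_osc B a
  have hexp : Continuous fun y => Real.exp (r * osc B a N y) :=
    Real.continuous_exp.comp (continuous_const.mul (contDiff_osc B a).continuous)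
  have hfi : IntegrableOn (fun y => Real.exp (r * osc B a N y)
      * (volDensity G y * gradSq G (osc B a N) y)) K :=
    (hexp.continuousOn.mul ((h.continuousOn_volDensity.mul
      (h.continuousOn_gradSq hosc2)).mono hB)).integrableOn_compact hK
  have hnn : ∀ y ∈ K, 0 ≤ Real.exp (r * osc B a N y)
      * (volDensity G y * gradSq G (osc B a N) y) := fun y hy =>
    mul_nonneg (Real.exp_pos _).le (mul_nonneg (Real.sqrt_nonneg _) (h.gradSq_nonneg (hB hy)))
  have hc1 : IntegrableOn (fun y : EuclideanSpace ℝ (Fin n) =>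
      Real.cos (2 * (N * (y a - y₀ a)))) b := by
    refine IntegrableOn.mono_set (t := K) ?_ hbK
    refine Continuous.continuousOn ?_ |>.integrableOn_compact hK
    fun_prop
  have hone : IntegrableOn (fun _ : EuclideanSpace ℝ (Fin n) => (1 : ℝ) / 2) b :=
    integrableOn_const hbf enorm_ne_top
  have hgi : IntegrableOn (fun y : EuclideanSpace ℝ (Fin n) =>
      q * (1 / 2 + 1 / 2 * Real.cos (2 * (N * (y a - y₀ a))))) b :=
    (hone.add (hc1.const_mul _)).const_mul _
  calc q * (volume.real b / 4)
      ≤ q * (volume.real b / 2 + 1 / 2 * ∫ y in b, Real.cos (2 * (N * (y a - y₀ a)))) := by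
        refine mul_le_mul_of_nonneg_left ?_ hqpos.le
        linarith
    _ = ∫ y in b, q * (1 / 2 + 1 / 2 * Real.cos (2 * (N * (y a - y₀ a)))) := by
        rw [integral_const_mul, integral_add hone (hc1.const_mul _), integral_const_mul,
          setIntegral_const, smul_eq_mul]
        ring
    _ ≤ ∫ y in b, Real.exp (r * osc B a N y) * (volDensity G y * gradSq G (osc B a N) y) := by
        refine setIntegral_mono_on hgi (hfi.mono_set hbK) hbm fun y hy => ?_
        have h1 : q * (1 / 2 + 1 / 2 * Real.cos (2 * (N * (y a - y₀ a))))
            = Real.exp (-|r|) * (m * Real.cos (N * (y a - y₀ a)) ^ 2) := by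
          rw [Real.cos_sq, hq]
          ring
        have h2 : volDensity G y * gradSq G (osc B a N) y
            = volDensity G y * (G y)⁻¹ a a * Real.cos (N * (y a - y₀ a)) ^ 2 := by
          rw [gradSq_osc B a hN.ne' hy]
          ring
        rw [h1, h2]
        have h3 : |r * osc B a N y| ≤ |r| := by
          rw [abs_mul]
          refine mul_le_of_le_one_right (abs_nonneg _) ((abs_osc_le B a hN).trans ?_)
          exact inv_le_one_of_one_le₀ hN1
        refine mul_le_mul (Real.exp_le_exp.2 (neg_le.1 ?_)) ?_ (by positivity) (Real.exp_pos _).le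
        · exact (neg_le_abs _).trans h3
        · exact mul_le_mul_of_nonneg_right (hmC y (hbK hy)).2.1 (sq_nonneg _)
    _ ≤ _ := by
        refine setIntegral_mono_set hfi ?_ hbK.eventuallyLE
        exact (ae_restrict_iff' Metric.isClosed_closedBall.measurableSet).2 (ae_of_all _ hnn)

/-- The total scalar curvature of the oscillating metrics exceeds that of their limit. -/
theorem exists_le_setIntegral_osc (h : IsMetricOn G Ω) (hn : 3 ≤ n)
    (hB : Metric.closedBall y₀ B.rOut ⊆ Ω) :
    ∃ C : ℝ, 0 < C ∧ ∀ᶠ N : ℝ in atTop, C ≤ ∫ y in Metric.closedBall y₀ B.rOut,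
      (volDensity (fun z => Real.exp (2 * osc B a N z) • G z) y
        * coordScalar (fun z => Real.exp (2 * osc B a N z) • G z) y
        - volDensity G y * coordScalar G y) := by
  obtain ⟨δ, hδ, hδN⟩ := h.exists_le_setIntegral_gradSq B a hB (n - 2)
  have hn' : (3 : ℝ) ≤ n := by exact_mod_cast hn
  have hc : 0 < ((n : ℝ) - 1) * (n - 2) := mul_pos (by linarith) (by linarith)
  -- Half of the gradient contribution is kept; the other half absorbs the curvature term that tends
  -- to `0`.
  refine ⟨(n - 1) * (n - 2) * δ / 2, by positivity, ?_⟩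
  filter_upwards [hδN, (h.tendsto_setIntegral_exp_sub_one B a hB (n - 2)).eventually_const_lt
    (show -((n - 1) * (n - 2) * δ / 2) < 0 by linarith [mul_pos hc hδ])] with N h1 h2
  rw [h.setIntegral_osc B a hB]
  have := mul_le_mul_of_nonneg_left h1 hc.le
  linarith

end IsMetricOn

end Oscillation

/-! ### Conformal metrics on manifolds -/

section ConformalMetrics

variable {k : ℕ∞} {n : ℕ} {M : Type*} [TopologicalSpace M]
  [ChartedSpace (EuclideanSpace ℝ (Fin n)) M] [IsManifold (𝓡 n) ∞ M]

theorem contMDiff_exp_mul {φ : M → ℝ} (hφ : ContMDiff (𝓡 n) 𝓘(ℝ) ∞ φ) (r : ℝ) :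
    ContMDiff (𝓡 n) 𝓘(ℝ) ∞ fun x => Real.exp (r * φ x) :=
  (Real.contDiff_exp.comp (contDiff_const.mul contDiff_id) :
    ContDiff ℝ ∞ fun t : ℝ => Real.exp (r * t)).contMDiff.comp hφ

set_option synthInstance.maxHeartbeats 400000 in
set_option maxHeartbeats 1000000 in
/-- The conformal metric `e^{2φ} g`. -/
def conformalMetric (g : Metric k n M) (φ : M → ℝ) (hφ : ContMDiff (𝓡 n) 𝓘(ℝ) ∞ φ) :
    Metric k n M where
  inner x := Real.exp (2 * φ x) • g.inner x
  symm x v w := by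
    change Real.exp (2 * φ x) * g.inner x v w = Real.exp (2 * φ x) * g.inner x w v
    rw [g.symm]
  pos x v hv := mul_pos (Real.exp_pos _) (g.pos x v hv)
  isVonNBounded x := by
    -- The unit ball of `e^{2φ} g` is the unit ball of `g` scaled by `e^{-φ}`.
    set c := Real.exp (-φ x) with hc
    have h := (g.isVonNBounded x).image (c • ContinuousLinearMap.id ℝ (TangentSpace (𝓡 n) x))
    refine Bornology.IsVonNBounded.subset ?_ h
    intro v hv
    refine ⟨Real.exp (φ x) • v, ?_, ?_⟩
    · have hv' : Real.exp (2 * φ x) * g.inner x v v < 1 := hv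
      have h2 : Real.exp (2 * φ x) = Real.exp (φ x) * Real.exp (φ x) := by
        rw [← Real.exp_add]
        congr 1
        ring
      rw [h2] at hv'
      change g.inner x (Real.exp (φ x) • v) (Real.exp (φ x) • v) < 1
      simp only [map_smul, smul_apply, smul_eq_mul]
      linarith
    · change c • Real.exp (φ x) • v = v
      rw [smul_smul, hc, ← Real.exp_add, neg_add_cancel, Real.exp_zero, one_smul]
  contMDiff := ContMDiff.smul_section ((contMDiff_exp_mul hφ 2).of_le (WithTop.coe_le_coe.2 le_top))
    g.contMDiff

variable (g : Metric k n M) {φ : M → ℝ} (hφ : ContMDiff (𝓡 n) 𝓘(ℝ) ∞ φ)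

theorem conformalMetric_inner (x : M) :
    (conformalMetric g φ hφ).inner x = Real.exp (2 * φ x) • g.inner x := rfl

theorem coeff_conformalMetric (x₀ : M) (y : EuclideanSpace ℝ (Fin n)) :
    coeff (conformalMetric g φ hφ) x₀ y
      = Real.exp (2 * φ ((extChartAt (𝓡 n) x₀).symm y)) • coeff g x₀ y := rfl

theorem isConformal_of_exp {g g' : Metric k n M} {φ : M → ℝ} (hφ : ContMDiff (𝓡 n) 𝓘(ℝ) ∞ φ)
    (h : ∀ x, g'.inner x = Real.exp (2 * φ x) • g.inner x) : IsConformal g' g :=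
  ⟨fun x => Real.exp (2 * φ x), (contMDiff_exp_mul hφ 2).of_le (WithTop.coe_le_coe.2 le_top),
    fun _ => Real.exp_pos _, fun x v w => by rw [h]; rfl⟩

theorem isMetricOn_coeff (hk : 2 ≤ k) (x₀ : M) :
    IsMetricOn (coeff g x₀) (extChartAt (𝓡 n) x₀).target where
  symm := coeff_isSymm g x₀
  posDef _ hy := coeff_posDef g hy
  contDiff _ hy := (matContDiffAt_coeff g hy).of_le (WithTop.coe_le_coe.2 hk)

/-- Conformal metrics converge if their conformal factors converge uniformly. -/
theorem convergesC0_conformalMetric {φ : ℕ → M → ℝ} (hφ : ∀ i, ContMDiff (𝓡 n) 𝓘(ℝ) ∞ (φ i))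
    {ε : ℕ → ℝ} (hε : Tendsto ε atTop (𝓝 0)) (hφε : ∀ i x, |φ i x| ≤ ε i) :
    ConvergesC0 (fun i => conformalMetric g (φ i) (hφ i)) g := by
  intro x₀ K hK hKΩ a b
  have hc : ContinuousOn (fun y => coeff g x₀ y a b) K := fun y hy =>
    (matContDiffAt_coeff g (hKΩ hy) a b).continuousAt.continuousWithinAt
  obtain ⟨C, hC⟩ := hK.exists_bound_of_continuousOn hc
  rw [Metric.tendstoUniformlyOn_iff]
  intro δ hδ
  -- The `4` combines `|e^t - 1| ≤ 2 |t|` with `|t| ≤ 2 ε`. The absolute value of `C` is taken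
  -- because on an empty `K` the bound may be negative.
  have hlim : Tendsto (fun i => 4 * ε i * |C|) atTop (𝓝 0) := by
    simpa using (hε.const_mul 4).mul_const |C|
  filter_upwards [hlim.eventually_lt_const hδ, hε.eventually_lt_const (show (0 : ℝ) < 1 / 2 by
    norm_num)] with i hi1 hi2 y hy
  set t := 2 * φ i ((extChartAt (𝓡 n) x₀).symm y) with ht
  have ht1 : |t| ≤ 2 * ε i := by
    rw [ht, abs_mul, abs_two]
    exact mul_le_mul_of_nonneg_left (hφε i _) zero_le_two
  have he : |Real.exp t - 1| ≤ 2 * |t| := Real.abs_exp_sub_one_le (by linarith)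
  rw [coeff_conformalMetric, Matrix.smul_apply, smul_eq_mul, ← ht, dist_comm, Real.dist_eq,
    show Real.exp t * coeff g x₀ y a b - coeff g x₀ y a b
      = (Real.exp t - 1) * coeff g x₀ y a b by ring, abs_mul]
  calc |Real.exp t - 1| * |coeff g x₀ y a b| ≤ (4 * ε i) * |C| := by
        refine mul_le_mul (by linarith) ((hC y hy).trans (le_abs_self C)) (abs_nonneg _) ?_
        linarith [abs_nonneg t]
    _ < δ := hi1

end ConformalMetrics

/-! ### The oscillating conformal metrics -/

section Oscillating

variable {k : ℕ∞} {n : ℕ} {M : Type*} [TopologicalSpace M]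
  [ChartedSpace (EuclideanSpace ℝ (Fin n)) M] [IsManifold (𝓡 n) ∞ M] {p : M}

/-- The oscillating function `N⁻¹ b sin (N (y^a - y^a(p)))` on a manifold. -/
def manifoldOsc (b : SmoothBumpFunction (𝓡 n) p) (a : Fin n) (N : ℝ) (x : M) : ℝ :=
  b x • (N⁻¹ * Real.sin (N * (extChartAt (𝓡 n) p x a - extChartAt (𝓡 n) p p a)))

variable (b : SmoothBumpFunction (𝓡 n) p) (a : Fin n) {N : ℝ}

/-- The sine factor is smooth only on the chart domain; the bump function extends the product
smoothly by zero. -/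
theorem contMDiff_manifoldOsc [T2Space M] : ContMDiff (𝓡 n) 𝓘(ℝ) ∞ (manifoldOsc b a N) := by
  refine b.contMDiff_smul ?_
  have h1 : ContDiff ℝ ∞ fun y : EuclideanSpace ℝ (Fin n) =>
      N⁻¹ * Real.sin (N * (y a - extChartAt (𝓡 n) p p a)) := by
    have h : ContDiff ℝ ∞ fun y : EuclideanSpace ℝ (Fin n) => y a := contDiff_piLp_apply 2
    exact contDiff_const.mul (contDiff_const.mul (h.sub contDiff_const)).sin
  exact h1.contMDiff.comp_contMDiffOn contMDiffOn_extChartAt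

theorem manifoldOsc_eq_zero {x : M} (hx : b x = 0) : manifoldOsc b a N x = 0 := by
  rw [manifoldOsc, hx, zero_smul]

theorem abs_manifoldOsc_le (hN : 0 < N) (x : M) : |manifoldOsc b a N x| ≤ N⁻¹ := by
  rw [manifoldOsc, smul_eq_mul, abs_mul, abs_mul, abs_of_nonneg b.nonneg,
    abs_of_pos (inv_pos.2 hN)]
  calc b x * (N⁻¹ * |Real.sin (N * (extChartAt (𝓡 n) p x a - extChartAt (𝓡 n) p p a))|)
      ≤ 1 * (N⁻¹ * 1) := by
        gcongr
        exacts [b.le_one, Real.abs_sin_le_one _]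
    _ = N⁻¹ := by ring

theorem manifoldOsc_symm {y : EuclideanSpace ℝ (Fin n)} (hy : y ∈ (extChartAt (𝓡 n) p).target) :
    manifoldOsc b a N ((extChartAt (𝓡 n) p).symm y) = osc b.toContDiffBump a N y := by
  have hs := (extChartAt (𝓡 n) p).map_target hy
  rw [extChartAt_source] at hs
  rw [manifoldOsc, osc, b.eqOn_source hs, Function.comp_apply, (extChartAt (𝓡 n) p).right_inv hy,
    smul_eq_mul]

theorem closedBall_subset_target :
    Metric.closedBall (extChartAt (𝓡 n) p p) b.rOut ⊆ (extChartAt (𝓡 n) p).target := by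
  simpa using b.closedBall_subset

variable [T2Space M] (g : Metric k n M)

/-- The metric `e^{2φ} g`, where `φ` oscillates. -/
def oscMetric (N : ℝ) : Metric k n M :=
  conformalMetric g (manifoldOsc b a N) (contMDiff_manifoldOsc b a)

theorem coeff_oscMetric_eventuallyEq {y : EuclideanSpace ℝ (Fin n)}
    (hy : y ∈ (extChartAt (𝓡 n) p).target) :
    coeff (oscMetric b a g N) p =ᶠ[𝓝 y]
      fun z => Real.exp (2 * osc b.toContDiffBump a N z) • coeff g p z := by
  filter_upwards [(isOpen_extChartAt_target (I := 𝓡 n) p).mem_nhds hy] with z hz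
  rw [oscMetric, coeff_conformalMetric, manifoldOsc_symm b a hz]

/-- At `p` the oscillation vanishes and its `a`-derivative is `1`, so `∂_a g_{aa}` differs from its
supposed limit by `2 g_{aa}(p) > 0` for every `N`. A one-point compact set detects this. -/
theorem not_convergesC1_oscMetric (hk : 2 ≤ k) {N : ℕ → ℝ} (hN : ∀ i, N i ≠ 0) :
    ¬ ConvergesC1 (fun i => oscMetric b a g (N i)) g := by
  rintro ⟨-, h⟩
  have hy₀ : extChartAt (𝓡 n) p p ∈ (extChartAt (𝓡 n) p).target := mem_extChartAt_target p
  have h1 := (h p {extChartAt (𝓡 n) p p} isCompact_singleton (singleton_subset_iff.2 hy₀) a a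
    a).tendsto_at (mem_singleton _)
  set y₀ := extChartAt (𝓡 n) p p
  have hG : DifferentiableAt ℝ (fun z => coeff g p z a a) y₀ :=
    ((matContDiffAt_coeff g hy₀).of_le (WithTop.coe_le_coe.2 hk : (2 : WithTop ℕ∞) ≤ k)
      ).differentiableAt two_ne_zero a a
  have hval : ∀ i, pderiv a (fun z => coeff (oscMetric b a g (N i)) p z a a) y₀
      = 2 * coeff g p y₀ a a + pderiv a (fun z => coeff g p z a a) y₀ := by
    intro i
    have hd : DifferentiableAt ℝ (osc b.toContDiffBump a (N i)) y₀ :=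
      (contDiff_two_osc b.toContDiffBump a).differentiable two_ne_zero _
    have h0 : osc b.toContDiffBump a (N i) y₀ = 0 := by simp [osc, y₀]
    have h2 := pderiv_osc b.toContDiffBump a (hN i)
      (Metric.mem_ball_self b.toContDiffBump.rIn_pos) a
    rw [if_pos rfl, sub_self, mul_zero, Real.cos_zero] at h2
    have h3 : (fun z => coeff (oscMetric b a g (N i)) p z a a) =ᶠ[𝓝 y₀]
        fun z => Real.exp (2 * osc b.toContDiffBump a (N i) z) * coeff g p z a a :=
      (coeff_oscMetric_eventuallyEq b a g hy₀ (N := N i)).mono fun z hz => by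
        simp only [hz, Matrix.smul_apply, smul_eq_mul]
    rw [pderiv_congr h3, pderiv_mul (hd.const_mul 2).exp hG,
      pderiv_scomp (f := fun z => 2 * osc b.toContDiffBump a (N i) z) (Real.hasDerivAt_exp _)
        (hd.const_mul 2), pderiv_const_mul hd, h2, h0]
    simp
  simp only [hval] at h1
  have h4 := tendsto_nhds_unique h1 tendsto_const_nhds
  have h5 : 0 < coeff g p y₀ a a := (coeff_posDef g hy₀).diag_pos
  linarith

theorem exists_scalarCurvature_pos_neg (hk : 2 ≤ k) (hn : 2 ≤ n) :
    ∀ᶠ N in atTop, (∃ x, 0 < scalarCurvature (oscMetric b a g N) x)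
      ∧ ∃ x, scalarCurvature (oscMetric b a g N) x < 0 := by
  filter_upwards [(isMetricOn_coeff g hk p).exists_coordScalar_pos_neg b.toContDiffBump a hn
    (closedBall_subset_target b)] with N hN
  have key : ∀ y ∈ (extChartAt (𝓡 n) p).target,
      scalarCurvature (oscMetric b a g N) ((extChartAt (𝓡 n) p).symm y)
      = coordScalar (fun z => Real.exp (2 * osc b.toContDiffBump a N z) • coeff g p z) y := by
    intro y hy
    rw [scalarCurvature_eq _ hk ((extChartAt (𝓡 n) p).map_target hy),
      (extChartAt (𝓡 n) p).right_inv hy, coordScalar_congr (coeff_oscMetric_eventuallyEq b a g hy)]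
  obtain ⟨⟨y, hy, h1⟩, z, hz, h2⟩ := hN
  exact ⟨⟨_, (key y hy).symm ▸ h1⟩, ⟨_, (key z hz).symm ▸ h2⟩⟩

/-- The two metrics differ only on the support of the bump, inside one chart, so the difference of
total curvatures is the coordinate integral already bounded below. -/
theorem exists_le_totalScalarCurvature [CompactSpace M] [MeasurableSpace M] [BorelSpace M]
    (hk : 2 ≤ k) (hn : 3 ≤ n) :
    ∃ C : ℝ, 0 < C ∧ ∀ᶠ N in atTop,
      totalScalarCurvature g + C ≤ totalScalarCurvature (oscMetric b a g N) := by
  obtain ⟨C, hC, hCN⟩ := (isMetricOn_coeff g hk p).exists_le_setIntegral_osc b.toContDiffBump a hn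
    (closedBall_subset_target b)
  refine ⟨C, hC, ?_⟩
  filter_upwards [hCN] with N hN
  have hout : ∀ x ∉ tsupport b, (oscMetric b a g N).inner x = g.inner x := by
    intro x hx
    rw [oscMetric, conformalMetric_inner, manifoldOsc_eq_zero b a (image_eq_zero_of_notMem_tsupport
      hx), mul_zero, Real.exp_zero, one_smul]
  have hsub := totalScalarCurvature_sub hk (isClosed_tsupport b)
    b.tsupport_subset_extChartAt_source hout
  have hpt : ∀ y ∈ (extChartAt (𝓡 n) p).target,
      volDensity (coeff (oscMetric b a g N) p) y * coordScalar (coeff (oscMetric b a g N) p) y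
        - volDensity (coeff g p) y * coordScalar (coeff g p) y
      = volDensity (fun z => Real.exp (2 * osc b.toContDiffBump a N z) • coeff g p z) y
        * coordScalar (fun z => Real.exp (2 * osc b.toContDiffBump a N z) • coeff g p z) y
        - volDensity (coeff g p) y * coordScalar (coeff g p) y := by
    intro y hy
    have he := coeff_oscMetric_eventuallyEq b a g hy (N := N)
    have hv := congrArg (fun A : Matrix (Fin n) (Fin n) ℝ => √A.det) he.self_of_nhds
    rw [coordScalar_congr he, show volDensity (coeff (oscMetric b a g N) p) y = _ from hv]
    rfl
  have hΩ := (isOpen_extChartAt_target (I := 𝓡 n) p).measurableSet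
  -- Outside the closed ball the oscillation vanishes locally and the two densities agree, which
  -- reduces the integral over the chart target to the ball.
  rw [setIntegral_congr_fun hΩ hpt, setIntegral_eq_of_subset_of_forall_sdiff_eq_zero hΩ
    (closedBall_subset_target b) ?_] at hsub
  · linarith
  · rintro y ⟨-, hy⟩
    have hz := osc_eventuallyEq_zero b.toContDiffBump a (N := N) hy
    have he : (fun z => Real.exp (2 * osc b.toContDiffBump a N z) • coeff g p z) =ᶠ[𝓝 y]
        coeff g p := by
      filter_upwards [hz] with z hz
      rw [hz, Pi.zero_apply, mul_zero, Real.exp_zero, one_smul]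
    have hv := congrArg (fun A : Matrix (Fin n) (Fin n) ℝ => √A.det) he.self_of_nhds
    rw [coordScalar_congr he]
    exact sub_eq_zero.2 (congrArg (· * coordScalar (coeff g p) y) hv)

end Oscillating

/-! ### The sequence and the two conclusions -/

theorem exists_oscillating_sequence {n : ℕ} (hn : 3 ≤ n) {M : Type*} [TopologicalSpace M]
    [ChartedSpace (EuclideanSpace ℝ (Fin n)) M] [IsManifold (𝓡 n) ∞ M]
    [CompactSpace M] [T2Space M] [MeasurableSpace M] [BorelSpace M]
    (k : ℕ∞) (hk : 2 ≤ k) (g₀ : Metric k n M) (p : M) (U : Set M) (hU : U ∈ 𝓝 p) :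
    ∃ (φ : ℕ → M → ℝ) (g : ℕ → Metric k n M),
      (∀ i, ContMDiff (𝓡 n) 𝓘(ℝ) ∞ (φ i)) ∧ (∀ i, ∀ x ∉ U, φ i x = 0) ∧
      (∀ i x, (g i).inner x = Real.exp (2 * φ i x) • g₀.inner x) ∧
      ConvergesC0 g g₀ ∧ ¬ ConvergesC1 g g₀ ∧
      (∃ C : ℝ, 0 < C ∧ ∀ᶠ i in atTop,
        totalScalarCurvature g₀ + C ≤ totalScalarCurvature (g i)) ∧
      (∀ᶠ i in atTop, (∃ x : M, 0 < scalarCurvature (g i) x) ∧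
        (∃ y : M, scalarCurvature (g i) y < 0)) := by
  obtain ⟨b, -, hb⟩ := (SmoothBumpFunction.nhds_basis_support (I := 𝓡 n) hU).mem_iff.1 hU
  let a : Fin n := ⟨0, by omega⟩
  -- The frequency `i + 1` is nonzero from the first index on, which the failure of `C¹` convergence
  -- uses for every `i`.
  have hN : Tendsto (fun i : ℕ => (i : ℝ) + 1) atTop atTop :=
    tendsto_atTop_add_const_right _ _ tendsto_natCast_atTop_atTop
  have hpos : ∀ i : ℕ, (0 : ℝ) < i + 1 := fun i => by positivity
  obtain ⟨C, hC, hCN⟩ := exists_le_totalScalarCurvature b a g₀ hk hn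
  refine ⟨fun i => manifoldOsc b a (i + 1), fun i => oscMetric b a g₀ (i + 1),
    fun i => contMDiff_manifoldOsc b a, fun i x hx => manifoldOsc_eq_zero b a ?_,
    fun i x => rfl, ?_, not_convergesC1_oscMetric b a g₀ hk fun i => (hpos i).ne',
    ⟨C, hC, hN.eventually hCN⟩,
    hN.eventually (exists_scalarCurvature_pos_neg b a g₀ hk (by omega))⟩
  · exact Function.notMem_support.1 fun h => hx (hb h)
  · exact convergesC0_conformalMetric g₀ (fun i => contMDiff_manifoldOsc b a)
      (tendsto_inv_atTop_zero.comp hN) fun i x => abs_manifoldOsc_le b a (hpos i) x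

end TotalScalarCurvature

end

theorem mainTheorem11 {n : ℕ} (hn : 3 ≤ n) {M : Type*} [TopologicalSpace M]
    [ChartedSpace (EuclideanSpace ℝ (Fin n)) M] [IsManifold (𝓡 n) ∞ M]
    [CompactSpace M] [T2Space M] [MeasurableSpace M] [BorelSpace M]
    (k : ℕ∞) (hk : 2 ≤ k) (g₀ : TotalScalarCurvature.Metric k n M)
    (p : M) (U : Set M) (hU : U ∈ 𝓝 p) :
    (∃ (u : ℕ → M → ℝ) (g : ℕ → TotalScalarCurvature.Metric k n M),
      (∀ i, ContMDiff (𝓡 n) 𝓘(ℝ) ∞ (u i)) ∧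
      (∀ i x, 0 < u i x) ∧
      (∀ i, ∀ x ∉ U, u i x = 1) ∧
      (∀ (i : ℕ) (x : M) (v w : TangentSpace (𝓡 n) x),
        (g i).inner x v w = (u i x) ^ ((4 : ℝ) / ((n : ℝ) - 2)) * g₀.inner x v w) ∧
      TotalScalarCurvature.ConvergesC0 g g₀ ∧
      ¬ TotalScalarCurvature.ConvergesC1 g g₀ ∧
      (∃ C : ℝ, 0 < C ∧ ∀ᶠ i in atTop,
        TotalScalarCurvature.totalScalarCurvature g₀ + C ≤
          TotalScalarCurvature.totalScalarCurvature (g i)) ∧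
      (∀ᶠ i in atTop,
        (∃ x : M, 0 < TotalScalarCurvature.scalarCurvature (g i) x) ∧
        (∃ y : M, TotalScalarCurvature.scalarCurvature (g i) y < 0))) ∧
    (¬ ∀ (κ : ℝ) (g : ℕ → TotalScalarCurvature.Metric k n M),
      TotalScalarCurvature.ConvergesC0 g g₀ →
      (∀ i, κ ≤ TotalScalarCurvature.totalScalarCurvature (g i)) →
      κ ≤ TotalScalarCurvature.totalScalarCurvature g₀) ∧
    (¬ ∀ (κ : ℝ) (g : ℕ → TotalScalarCurvature.Metric k n M),
      (∀ i, TotalScalarCurvature.IsConformal (g i) g₀) →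
      TotalScalarCurvature.ConvergesC0 g g₀ →
      (∀ i, κ ≤ TotalScalarCurvature.totalScalarCurvature (g i)) →
      κ ≤ TotalScalarCurvature.totalScalarCurvature g₀) := by
  obtain ⟨φ, g, hφ, hφU, hg, hC0, hC1, ⟨C, hC, hCg⟩, hsign⟩ :=
    TotalScalarCurvature.exists_oscillating_sequence hn k hk g₀ p U hU
  have hn2 : (n : ℝ) - 2 ≠ 0 := by
    have : (3 : ℝ) ≤ n := by exact_mod_cast hn
    linarith
  obtain ⟨m, hm⟩ := eventually_atTop.1 hCg
  -- The curvature gap holds only eventually, while the refuted assertions ask for it at all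
  -- indices, so the first `m` metrics are dropped.
  have hshift : TotalScalarCurvature.ConvergesC0 (fun i => g (i + m)) g₀ :=
    fun x₀ K hK hKΩ a b v hv => (tendsto_add_atTop_nat m).eventually (hC0 x₀ K hK hKΩ a b v hv)
  have hconf : ∀ i, TotalScalarCurvature.IsConformal (g (i + m)) g₀ := fun i =>
    TotalScalarCurvature.isConformal_of_exp (hφ (i + m)) (hg (i + m))
  have hle : ∀ i, TotalScalarCurvature.totalScalarCurvature g₀ + C ≤
      TotalScalarCurvature.totalScalarCurvature (g (i + m)) := fun i => hm _ (Nat.le_add_left m i)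
  -- The exponent `(n - 2) / 2` is chosen so that the power `4 / (n - 2)` returns `e^{2φ}`.
  refine ⟨⟨fun i x => Real.exp (((n : ℝ) - 2) / 2 * φ i x), g,
    fun i => TotalScalarCurvature.contMDiff_exp_mul (hφ i) _, fun _ _ => Real.exp_pos _,
    fun i x hx => ?_, fun i x v w => ?_, hC0, hC1, ⟨C, hC, hCg⟩, hsign⟩, fun h => ?_, fun h => ?_⟩
  · simp only [hφU i x hx, mul_zero, Real.exp_zero]
  · rw [hg, ← Real.exp_mul, show ((n : ℝ) - 2) / 2 * φ i x * (4 / ((n : ℝ) - 2)) = 2 * φ i x by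
      field_simp
      ring]
    rfl
  -- Here `κ` is the total curvature of `g₀` plus `C`, so the conclusion would give `C ≤ 0`.
  · linarith [h _ _ hshift hle]
  · linarith [h _ _ hconf hshift hle]
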